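/- For a real number $0<\theta<1$, an integer $n\ge 1$ and $s\in\mathbb C$, let \[ \zeta_{\mathbb Z/n\mathbb Z}(s,\theta)=\sum_{j=0}^{n-1}\Big[4\sin^2\Big(\frac{\pi(j+\theta)}{n}\Big)\Big]^{-s}, \qquad \zeta_{\mathbb R/\mathbb Z}(s,\theta)=(2\pi)^{-2s}\big[\zeta(2s,\theta)+\zeta(2s,1-\theta)\big]\quad (s\neq\tfrac12), \] where $\zeta(s,\theta)$ is the meromorphically continued Hurwitz zeta function $\sum_{l\ge 0}(l+\theta)^{-s}$. For $0<\theta<1$ and $s\ne\frac12$ the function $\zeta_{\mathbb R/\mathbb Z}(s,\theta)$ is differentiable in $\theta$, with \[ \partial_\theta\zeta_{\mathbb R/\mathbb Z}(s,\theta)=-2s(2\pi)^{-2s}\big[\zeta(1+2s,\theta)-\zeta(1+2s,1-\theta)\big], \] and the right-hand side extends to an entire function of $s$ (the poles of the two Hurwitz zeta functions at $s=0$ cancel), which is denoted $\partial_\theta\zeta_{\mathbb R/\mathbb Z}(s,\theta)$ for every $s\in\mathbb C$. Let $a_k(s)$, $k\ge0$, be given by the Taylor expansion at $z=0$ \[ \Big(\frac{z/2}{\sin(z/2)}\Big)^{2s}=\sum_{k\ge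 0}a_k(s)z^{2k}. \] Let $\zeta_{\mathbb Z}(s)=\frac{1}{\Gamma(s)}\int_0^\infty K_{\mathbb Z}(t,0,0)\,t^{s}\,\frac{dt}{t}$ for $0<\operatorname{Re}s<\frac12$, where $K_{\mathbb Z}(t,x,y)$ is the kernel of $e^{-t\Delta}$ for the Laplacian $(\Delta f)(x)=2f(x)-f(x+1)-f(x-1)$ on $\mathbb Z$; it extends to a holomorphic function on $\mathbb C\setminus\{\frac12,\frac32,\frac52,\dots\}$, again denoted $\zeta_{\mathbb Z}$. Then for every $s\in\mathbb C\setminus\{\frac12,\frac32,\frac52,\dots\}$, every $0<\theta<1$ and every integer $m\ge 0$, as $n\to\infty$, \[ \zeta_{\mathbb Z/n\mathbb Z}(s,\theta)=n\,\zeta_{\mathbb Z}(s)+n^{2s}\Big(\sum_{k=0}^{m}a_k(s)\,\zeta_{\mathbb R/\mathbb Z}(s-k,\theta)\,n^{-2k}+\mathcal O(n^{-2-2m})\Big), \] and for every $s\in\mathbb C$, every $0<\theta<1$ and every integer $m\ge0$, as $n\to\infty$, \[ \partial_\theta\zeta_{\mathbb Z/n\mathbb Z}(s,\theta)=n^{2s}\Big(\sum_{k=0}^{m}a_k(s)\,\partial_\theta\zeta_{\mathbb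 R/\mathbb Z}(s-k,\theta)\,n^{-2k}+\mathcal O(n^{-2-2m})\Big). \] The implied constants may depend on $s$, $\theta$ and $m$. -/

import Mathlib

open Filter Asymptotics

noncomputable section

namespace BundleZeta

/-- The combinatorial Laplacian of the Cayley graph of `ℤ` with generator `1`. -/
def latticeLaplacian (f : ℤ → ℂ) : ℤ → ℂ :=
  fun x => 2 * f x - f (x + 1) - f (x - 1)

/-- The heat kernel `K_ℤ(t, x, y)`, i.e. the `(x, y)` matrix entry of `exp (-t Δ)`. The Laplacian
is bounded on `ℓ²(ℤ)`, so the exponential is given by its (absolutely convergent) power series. -/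
def latticeHeatKernel (t : ℝ) (x y : ℤ) : ℂ :=
  ∑' k : ℕ, (-(t : ℂ)) ^ k / (k.factorial : ℂ) * (latticeLaplacian^[k] (Pi.single y 1)) x

/-- `Z` is the spectral zeta function of `ℤ`: on the strip `0 < Re s < 1/2` it is the (convergent)
Mellin transform `Γ(s)⁻¹ ∫₀^∞ K_ℤ(t, 0, 0) t ^ s dt / t`, and it is holomorphic on the complement
of `{1/2, 3/2, 5/2, …}`. As this complement is connected, `Z` is uniquely determined on it. -/
structure IsLatticeZeta (Z : ℂ → ℂ) : Prop where
  mellinConvergent : ∀ s : ℂ, 0 < s.re → s.re < 1 / 2 →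
    MellinConvergent (fun t : ℝ => latticeHeatKernel t 0 0) s
  eq_mellin : ∀ s : ℂ, 0 < s.re → s.re < 1 / 2 →
    Z s = (Complex.Gamma s)⁻¹ * mellin (fun t : ℝ => latticeHeatKernel t 0 0) s
  differentiableOn : DifferentiableOn ℂ Z {s : ℂ | ∀ k : ℕ, s ≠ (k : ℂ) + 1 / 2}

/-- The zeta function `ζ_{ℤ/nℤ}(s, θ)` of the bundle Laplacian on the discrete circle. -/
def discreteZeta (n : ℕ) (s : ℂ) (θ : ℝ) : ℂ :=
  ∑ j ∈ Finset.range n,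
    ((4 * Real.sin (Real.pi * ((j : ℝ) + θ) / (n : ℝ)) ^ 2 : ℝ) : ℂ) ^ (-s)

/-- The zeta function `ζ_{ℝ/ℤ}(s, θ) = (2π)^{-2s} [ζ(2s, θ) + ζ(2s, 1 - θ)]` of the bundle
Laplacian on the circle, for `0 < θ < 1`. -/
def circleZeta (s : ℂ) (θ : ℝ) : ℂ :=
  ((2 * Real.pi : ℝ) : ℂ) ^ (-2 * s) *
    (HurwitzZeta.hurwitzZeta (θ : UnitAddCircle) (2 * s) +
      HurwitzZeta.hurwitzZeta ((1 - θ : ℝ) : UnitAddCircle) (2 * s))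

/-- The entire function `∂_θ ζ_{ℝ/ℤ}(s, θ) = -2s (2π)^{-2s} [ζ(1 + 2s, θ) - ζ(1 + 2s, 1 - θ)]`
of `s`, for `0 < θ < 1`. The difference of the two Hurwitz zeta functions has no pole; the value
at `s = 0` is the one by continuity. -/
def circleZetaDeriv (s : ℂ) (θ : ℝ) : ℂ :=
  -2 * s * ((2 * Real.pi : ℝ) : ℂ) ^ (-2 * s) *
    (HurwitzZeta.hurwitzZeta (θ : UnitAddCircle) (1 + 2 * s) -
      HurwitzZeta.hurwitzZeta ((1 - θ : ℝ) : UnitAddCircle) (1 + 2 * s))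

/-- The coefficient `a_k(s)` of `z ^ (2k)` in the Taylor expansion at `z = 0` of
`((z / 2) / sin (z / 2)) ^ (2s)`. -/
def taylorCoeff (k : ℕ) (s : ℂ) : ℂ :=
  iteratedDeriv (2 * k)
    (fun z : ℂ => (if z = 0 then 1 else z / 2 / Complex.sin (z / 2)) ^ (2 * s)) 0 /
      ((2 * k).factorial : ℂ)

end BundleZeta

end

noncomputable section

namespace BundleZeta

open Complex Topology MeasureTheory HurwitzZeta

/-! ### Binomial coefficients -/

/-! With `φ(x) = (4 sin² πx)^(-s)` (`symbol`), the discrete zeta function is the shifted Riemann sum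
`∑ φ((j + θ)/n)`. The integrand is singular at `x = 0` and `x = 1`; the proof removes the
singularities by functions whose Riemann sums are known exactly.

On `0 < x < 1` one has `φ(x) = (2πx)^(-2s) ((z/2)/sin(z/2))^(2s)` at `z = 2πx`, hence `φ(x) = ∑
a_k(s) (2πx)^(-2(s-k))`. The function `circleZeta (s - k)` has exactly the singular part
`(2πx)^(-2(s-k))` at `0` (`circleZeta_eq`), and like `φ` it is invariant under `x ↦ 1 - x`. So `φ -
∑_{k<M} a_k(s) circleZeta (s - k)` (`evenPart_eq`) extends to a 1-periodic function that is as
smooth as desired once `M` is large (`exists_periodic_extension`), and its Riemann sums are `n`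
times its integral up to a high power of `1/n` (`exists_norm_sum_sub_integral_le`). The subtracted
terms are summed exactly by the distribution relation of the Hurwitz zeta function
(`sum_circleZeta`), which produces `n^(2(s-k)) circleZeta (s - k) θ`. Terms with `k > m` are then
thrown into the error (`isBigO_of_expansion`).

The remaining integral is `ζ_ℤ(s)`. The finite-part integral of each circle zeta function over a
period is zero (`integral_hurwitzTail`), so what is left is the finite-part integral of `φ`, namely
the series `latticeZeta` (`integral_evenPart`). For `0 < Re s < 1/2` it is an honest integral, and
the Fourier representation of the heat kernel identifies it with the Mellin transform
(`isLatticeZeta_latticeZeta`).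

The derivative in `θ` is treated in the same way with `oddPart`. This function is antisymmetric
under `x ↦ 1 - x`, so its integral vanishes: there is no term in `n`, and no `s` has to be excluded.
-/

lemma succ_mul_choose_succ (a : ℂ) (j : ℕ) :
    ((j : ℂ) + 1) * Ring.choose a (j + 1) = Ring.choose a j * (a - j) := by
  have := Ring.choose_smul_choose a (Nat.le_succ j)
  simpa [Ring.choose_one_right] using this

lemma succ_mul_choose_succ' (a : ℂ) (j : ℕ) :
    ((j : ℂ) + 1) * Ring.choose a (j + 1) = a * Ring.choose (a - 1) j := by
  have := Ring.choose_smul_choose a (Nat.le_add_left 1 j)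
  simpa [Ring.choose_one_right] using this

/-- Consecutive coefficients have ratio at most `(j + R + 1)/(j + 1)` in norm, which is the ratio
for the right-hand side. The growth in `j` is thus polynomial, uniformly for `w` in a disc. -/
lemma norm_choose_neg_le {w : ℂ} {R : ℕ} (hw : ‖w‖ ≤ R) (j : ℕ) :
    ‖Ring.choose (-w) j‖ ≤ ((j + R).choose R : ℝ) := by
  induction j with
  | zero => simp
  | succ j ih =>
    have h := congrArg norm (succ_mul_choose_succ (-w) j)
    have h1 : ‖(j : ℂ) + 1‖ = (j : ℝ) + 1 := by
      rw [← Nat.cast_succ, Complex.norm_natCast, Nat.cast_succ]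
    rw [norm_mul, norm_mul, h1] at h
    have h2 : ‖-w - j‖ ≤ (R : ℝ) + j := by
      calc ‖-w - j‖ ≤ ‖-w‖ + ‖(j : ℂ)‖ := norm_sub_le _ _
        _ ≤ _ := by rw [norm_neg, Complex.norm_natCast]; gcongr
    have h3 : ((j : ℝ) + 1) * ((j + 1 + R).choose R : ℝ) = (R + j + 1) * ((j + R).choose R : ℝ) := by
      have := Nat.add_one_mul_choose_eq (j + R) j
      have e1 : (j + R + 1).choose (j + 1) = (j + 1 + R).choose R := by
        rw [← Nat.choose_symm_add, show j + R + 1 = j + 1 + R by omega]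
      have e2 : (j + R).choose j = (j + R).choose R := by rw [← Nat.choose_symm_add]
      rw [e1, e2] at this
      have := congrArg (Nat.cast (R := ℝ)) this
      push_cast at this
      linarith
    have hj : (0 : ℝ) < j + 1 := by positivity
    refine le_of_mul_le_mul_left ?_ hj
    rw [h, h3]
    calc _ ≤ ((j + R).choose R : ℝ) * (R + j) := by gcongr
      _ ≤ _ := by nlinarith [show (0 : ℝ) ≤ ((j + R).choose R : ℝ) by positivity]

lemma differentiable_choose_neg (j : ℕ) : Differentiable ℂ (fun w : ℂ => Ring.choose (-w) j) := by
  induction j with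
  | zero => simp
  | succ j ih =>
    have : (fun w : ℂ => Ring.choose (-w) (j + 1)) =
        fun w => Ring.choose (-w) j * (-w - j) / ((j : ℂ) + 1) := by
      ext w
      rw [← succ_mul_choose_succ, mul_div_cancel_left₀ _ (Nat.cast_add_one_ne_zero j)]
    rw [this]
    fun_prop

/-! ### The entire function `(u - 1) ζ(u)` -/

/-- The entire function `(u - 1) ζ(u)`. -/
def zetaReg : ℂ → ℂ := Function.update (fun u => (u - 1) * riemannZeta u) 1 1

lemma zetaReg_of_ne {u : ℂ} (hu : u ≠ 1) : zetaReg u = (u - 1) * riemannZeta u := by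
  simp [zetaReg, hu]

lemma differentiable_zetaReg : Differentiable ℂ zetaReg := by
  have h0 : ∀ u : ℂ, u ≠ 1 → DifferentiableAt ℂ zetaReg u := fun u hu => by
    have : zetaReg =ᶠ[𝓝 u] fun u => (u - 1) * riemannZeta u := by
      filter_upwards [isOpen_ne.mem_nhds hu] with v hv using zetaReg_of_ne hv
    exact this.differentiableAt_iff.2 <|
      (differentiableAt_id.sub_const 1).mul (differentiableAt_riemannZeta hu)
  intro u
  by_cases hu : u = 1
  · subst hu
    refine (analyticAt_of_differentiable_on_punctured_nhds_of_continuousAt ?_ ?_).differentiableAt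
    · filter_upwards [self_mem_nhdsWithin] with v hv using h0 v hv
    -- The value `1` is the residue of `ζ` at its pole, so the singularity is removable.
    · exact continuousAt_update_same.2 riemannZeta_residue_one
  · exact h0 u hu

lemma exists_norm_riemannZeta_le : ∃ C : ℝ, ∀ u : ℂ, 2 ≤ u.re → ‖riemannZeta u‖ ≤ C := by
  refine ⟨∑' n : ℕ, 1 / ((n : ℝ) + 1) ^ 2, fun u hu => ?_⟩
  rw [zeta_eq_tsum_one_div_nat_add_one_cpow (by linarith)]
  have hs : Summable fun n : ℕ => 1 / ((n : ℝ) + 1) ^ 2 := by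
    have := (summable_nat_add_iff 1).2 (Real.summable_one_div_nat_pow.2 one_lt_two)
    simpa using this
  refine tsum_of_norm_bounded hs.hasSum fun n => ?_
  rw [norm_div, norm_one, ← Nat.cast_succ, Complex.norm_natCast_cpow_of_pos n.succ_pos,
    Nat.cast_succ]
  gcongr
  rw [← Real.rpow_natCast]
  exact Real.rpow_le_rpow_of_exponent_le (by simp) (by simpa using hu)

/-! ### The Taylor expansion of the Hurwitz zeta function in its second variable -/

/-- Taylor coefficients of `ζ(w, 1 + z)` at `z = 0`: the coefficient of `z ^ (j + 1)`, which is
`binom(-w, j + 1) ζ(w + j + 1)` with its removable singularity removed. -/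
def tailCoeff (w : ℂ) (j : ℕ) : ℂ :=
  -Ring.choose (-w) j / (j + 1) * zetaReg (w + j + 1)

/-- The function `ζ(w, 1 + z) - ζ(w)` for `‖z‖ < 1`, entire in `w`. -/
def hurwitzTail (w z : ℂ) : ℂ := ∑' j : ℕ, tailCoeff w j * z ^ (j + 1)

/-- For `j ≤ R` the argument of `zetaReg` stays in a fixed disc. For `j > R` its real part is at
least `2`, where `ζ` is bounded, and the factor `w + j` is absorbed by the denominator `j + 1`. -/
lemma exists_norm_tailCoeff_le (R : ℕ) : ∃ C : ℝ, 0 ≤ C ∧ ∀ w : ℂ, ‖w‖ ≤ R → ∀ j : ℕ,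
    ‖tailCoeff w j‖ ≤ C * ((j + R).choose R : ℝ) := by
  obtain ⟨Cz, hCz⟩ := exists_norm_riemannZeta_le
  have hCz0 : 0 ≤ Cz := (norm_nonneg _).trans (hCz 2 (by simp))
  obtain ⟨D, hD⟩ := (isCompact_closedBall (0 : ℂ) (2 * R + 1)).exists_bound_of_continuousOn
    differentiable_zetaReg.continuous.continuousOn
  have hD0 : 0 ≤ D := (norm_nonneg _).trans (hD 0 (by simp; positivity))
  refine ⟨D + (R + 1) * Cz, by positivity, fun w hw j => ?_⟩
  have hj : (0 : ℝ) < j + 1 := by positivity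
  have hnj : ‖(j : ℂ) + 1‖ = (j : ℝ) + 1 := by
    rw [← Nat.cast_succ, Complex.norm_natCast, Nat.cast_succ]
  rw [tailCoeff, norm_mul, norm_div, norm_neg, hnj]
  have hmain : ‖zetaReg (w + j + 1)‖ / (j + 1) ≤ D + (R + 1) * Cz := by
    rcases le_or_gt j R with hjR | hjR
    · have : ‖zetaReg (w + j + 1)‖ ≤ D := by
        refine hD _ ?_
        rw [mem_closedBall_zero_iff]
        calc ‖w + j + 1‖ ≤ ‖w‖ + ‖(j : ℂ) + 1‖ := by rw [add_assoc]; exact norm_add_le _ _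
          _ ≤ R + (R + 1) := by rw [hnj]; gcongr
          _ = _ := by ring
      calc _ ≤ D / 1 := div_le_div₀ hD0 this one_pos (by simp)
        _ ≤ _ := by rw [div_one]; linarith [show 0 ≤ (R + 1) * Cz by positivity]
    · have hre : 2 ≤ (w + j + 1).re := by
        have h1 := (abs_le.1 (Complex.abs_re_le_norm w)).1
        have h2 : (R : ℝ) + 1 ≤ j := by exact_mod_cast hjR
        simp only [add_re, natCast_re, one_re]
        linarith
      have hne : w + j + 1 ≠ 1 := fun h => by rw [h] at hre; norm_num at hre
      rw [zetaReg_of_ne hne, add_sub_cancel_right, norm_mul, div_le_iff₀ hj]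
      have hwj : ‖w + j‖ ≤ (R + 1) * (j + 1) := by
        calc ‖w + j‖ ≤ ‖w‖ + ‖(j : ℂ)‖ := norm_add_le _ _
          _ ≤ R + j := by rw [Complex.norm_natCast]; gcongr
          _ ≤ _ := by nlinarith [show (0 : ℝ) ≤ R * j by positivity]
      calc _ ≤ ((R + 1) * (j + 1)) * Cz := by gcongr; exact hCz _ hre
        _ ≤ _ := by nlinarith
  calc _ = ‖Ring.choose (-w) j‖ * (‖zetaReg (w + j + 1)‖ / (j + 1)) := by ring
    _ ≤ ((j + R).choose R : ℝ) * (D + (R + 1) * Cz) := by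
      gcongr
      exact norm_choose_neg_le hw j
    _ = _ := by ring

lemma exists_summable_bound_tail (R : ℕ) {r : ℝ} (h0 : 0 ≤ r) (hr : r < 1) :
    ∃ u : ℕ → ℝ, Summable u ∧ ∀ w z : ℂ, ‖w‖ ≤ R → ‖z‖ ≤ r → ∀ j : ℕ,
      ‖tailCoeff w j * z ^ (j + 1)‖ ≤ u j := by
  obtain ⟨C, hC0, hC⟩ := exists_norm_tailCoeff_le R
  refine ⟨fun j => C * r * (((j + R).choose R : ℝ) * r ^ j), ?_, fun w z hw hz j => ?_⟩
  · refine Summable.mul_left _ (summable_choose_mul_geometric_of_norm_lt_one R ?_)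
    rwa [Real.norm_of_nonneg h0]
  · rw [norm_mul, norm_pow]
    calc _ ≤ (C * ((j + R).choose R : ℝ)) * r ^ (j + 1) := by gcongr; exact hC w hw j
      _ = _ := by ring

lemma hasSum_hurwitzTail (w : ℂ) {z : ℂ} (hz : ‖z‖ < 1) :
    HasSum (fun j : ℕ => tailCoeff w j * z ^ (j + 1)) (hurwitzTail w z) := by
  obtain ⟨R, hR⟩ := exists_nat_ge ‖w‖
  obtain ⟨u, hu, hb⟩ := exists_summable_bound_tail R (norm_nonneg z) hz
  exact (Summable.of_norm_bounded hu fun j => hb w z hR le_rfl j).hasSum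

lemma differentiable_tailCoeff (j : ℕ) : Differentiable ℂ (fun w => tailCoeff w j) := by
  unfold tailCoeff
  have h1 := differentiable_choose_neg j
  have h2 := differentiable_zetaReg
  fun_prop

lemma differentiable_hurwitzTail {z : ℂ} (hz : ‖z‖ < 1) :
    Differentiable ℂ (fun w => hurwitzTail w z) := by
  intro w
  obtain ⟨R, hR⟩ := exists_nat_gt ‖w‖
  obtain ⟨u, hu, hb⟩ := exists_summable_bound_tail R (norm_nonneg z) hz
  have := Complex.differentiableOn_tsum_of_summable_norm (U := Metric.ball (0 : ℂ) R)
    (F := fun j w => tailCoeff w j * z ^ (j + 1)) hu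
    (fun j => ((differentiable_tailCoeff j).mul_const _).differentiableOn) Metric.isOpen_ball
    (fun j w hw => hb w z (mem_ball_zero_iff.1 hw).le le_rfl j)
  exact this.differentiableAt (Metric.isOpen_ball.mem_nhds (by simpa using hR))

lemma differentiableOn_hurwitzTail (w : ℂ) :
    DifferentiableOn ℂ (hurwitzTail w) (Metric.ball 0 1) := by
  intro z hz
  obtain ⟨r, hzr, hr⟩ := exists_between (mem_ball_zero_iff.1 hz)
  obtain ⟨R, hR⟩ := exists_nat_ge ‖w‖
  obtain ⟨u, hu, hb⟩ := exists_summable_bound_tail R ((norm_nonneg z).trans hzr.le) hr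
  have := Complex.differentiableOn_tsum_of_summable_norm (U := Metric.ball (0 : ℂ) r)
    (F := fun j z => tailCoeff w j * z ^ (j + 1)) hu
    (fun j => by fun_prop) Metric.isOpen_ball
    (fun j z hz => hb w z hR (mem_ball_zero_iff.1 hz).le j)
  exact (this.differentiableAt
    (Metric.isOpen_ball.mem_nhds (by simpa using hzr))).differentiableWithinAt

/-- This is `∂_z ζ(w, 1 + z) = -w ζ(w + 1, 1 + z)`. The constant term `-w ζ(w + 1)` appears as
`-zetaReg (w + 1)`, so that `w = 0` is covered. -/
lemma hasDerivAt_hurwitzTail (w : ℂ) {z : ℂ} (hz : ‖z‖ < 1) :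
    HasDerivAt (hurwitzTail w) (-zetaReg (w + 1) - w * hurwitzTail (w + 1) z) z := by
  obtain ⟨r, hzr, hr⟩ := exists_between hz
  obtain ⟨R, hR⟩ := exists_nat_ge ‖w‖
  obtain ⟨u, hu, hb⟩ := exists_summable_bound_tail R ((norm_nonneg z).trans hzr.le) hr
  have hs := Complex.hasSum_deriv_of_summable_norm (U := Metric.ball (0 : ℂ) r)
    (F := fun j z => tailCoeff w j * z ^ (j + 1)) (z := z) hu
    (fun j => by fun_prop) Metric.isOpen_ball
    (fun j z hz => hb w z hR (mem_ball_zero_iff.1 hz).le j) (by simpa using hzr)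
  have hd : ∀ j : ℕ, deriv (fun z => tailCoeff w j * z ^ (j + 1)) z =
      -Ring.choose (-w) j * zetaReg (w + j + 1) * z ^ j := fun j => by
    have : ((j : ℂ) + 1) ≠ 0 := Nat.cast_add_one_ne_zero j
    rw [deriv_const_mul _ (by fun_prop), deriv_pow_field, tailCoeff]
    push_cast
    field_simp
  have h2 : HasSum (fun j : ℕ => -Ring.choose (-w) j * zetaReg (w + j + 1) * z ^ j)
      (-zetaReg (w + 1) - w * hurwitzTail (w + 1) z) := by
    rw [← hasSum_nat_add_iff' 1]
    have h3 := (hasSum_hurwitzTail (w + 1) hz).mul_left (-w)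
    convert! h3 using 1
    · funext j
      have hj : ((j : ℂ) + 1) ≠ 0 := Nat.cast_add_one_ne_zero j
      have := succ_mul_choose_succ' (-w) j
      rw [tailCoeff, show -(w + 1) = -w - 1 by ring]
      push_cast
      rw [show w + ((j : ℂ) + 1) + 1 = w + 1 + j + 1 by ring]
      field_simp
      linear_combination -zetaReg (w + 1 + j + 1) * z ^ (j + 1) * this
    · simp
      ring
  have h3 : deriv (hurwitzTail w) z = -zetaReg (w + 1) - w * hurwitzTail (w + 1) z := by
    refine HasSum.unique (f := fun j : ℕ => deriv (fun z => tailCoeff w j * z ^ (j + 1)) z) hs ?_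
    simpa only [hd] using h2
  rw [← h3]
  exact ((differentiableOn_hurwitzTail w).differentiableAt
    (Metric.isOpen_ball.mem_nhds (by simpa using hz))).hasDerivAt

lemma hasSum_binomial (a : ℂ) {x : ℂ} (hx : ‖x‖ < 1) :
    HasSum (fun j : ℕ => Ring.choose a j * x ^ j) ((1 + x) ^ a) := by
  have h := (Complex.one_add_cpow_hasFPowerSeriesOnBall_zero (a := a)).hasSum (y := x)
    (by rw [← ENNReal.ofReal_one, Metric.eball_ofReal]; simpa using hx)
  simpa only [binomialSeries_apply, zero_add, smul_eq_mul, List.ofFn_const, List.prod_replicate]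
    using h

/-- Complex powers are multiplicative here because both factors of `n + 1 + y` are nonnegative
reals. -/
lemma one_add_div_cpow {y : ℝ} (hy : |y| < 1) (w : ℂ) (n : ℕ) :
    1 / ((n : ℂ) + 1) ^ w * (1 + y / ((n : ℂ) + 1)) ^ (-w) = 1 / ((n : ℂ) + 1 + y) ^ w := by
  have hn : (0 : ℝ) < n + 1 := by positivity
  have hy' := (abs_lt.1 hy).1
  have h1 : (0 : ℝ) ≤ 1 + y / (n + 1) := by
    rw [show 1 + y / ((n : ℝ) + 1) = (n + 1 + y) / (n + 1) by field_simp]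
    exact div_nonneg (by linarith [(Nat.cast_nonneg n : (0 : ℝ) ≤ n)]) hn.le
  have h2 := Complex.mul_cpow_ofReal_nonneg hn.le h1 (-w)
  rw [one_div, ← Complex.cpow_neg, one_div, ← Complex.cpow_neg]
  push_cast at h2
  rw [← h2]
  congr 1
  have : ((n : ℂ) + 1) ≠ 0 := Nat.cast_add_one_ne_zero n
  field_simp

lemma one_div_add_cpow_sub_hasSum {y : ℝ} (hy : |y| < 1) (w : ℂ) (n : ℕ) :
    HasSum (fun j : ℕ => Ring.choose (-w) (j + 1) * (y : ℂ) ^ (j + 1) *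
      (1 / ((n : ℂ) + 1) ^ (w + j + 1)))
      (1 / ((n : ℂ) + 1 + y) ^ w - 1 / ((n : ℂ) + 1) ^ w) := by
  have hn0 : ((n : ℂ) + 1) ≠ 0 := Nat.cast_add_one_ne_zero n
  have hlt : ‖(y : ℂ) / ((n : ℂ) + 1)‖ < 1 := by
    rw [norm_div, ← Nat.cast_succ, Complex.norm_natCast, Complex.norm_real, Real.norm_eq_abs]
    rw [div_lt_one (by positivity)]
    refine hy.trans_le ?_
    simp
  have h := (hasSum_binomial (-w) hlt).mul_left (1 / ((n : ℂ) + 1) ^ w)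
  rw [one_add_div_cpow hy, ← hasSum_nat_add_iff' 1] at h
  simp only [Finset.sum_range_one, Ring.choose_zero_right, pow_zero, mul_one] at h
  refine h.congr_fun ?_
  intro j
  rw [add_assoc w, Complex.cpow_add _ _ hn0, ← Nat.cast_succ j, Complex.cpow_natCast, div_pow]
  field_simp

lemma hasSum_riemannZeta {w : ℂ} (hw : 1 < w.re) :
    HasSum (fun n : ℕ => 1 / ((n : ℂ) + 1) ^ w) (riemannZeta w) := by
  rw [zeta_eq_tsum_one_div_nat_add_one_cpow hw]
  have := (summable_nat_add_iff 1).2 (Complex.summable_one_div_nat_cpow.2 hw)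
  exact Summable.hasSum (by simpa using this)

/-- Expand each `(n + 1 + y)^(-w)` by the binomial series in `y/(n + 1)` and interchange the sums.
The double series is dominated by a product of a series in `j` and a series in `n`. -/
lemma hasSum_sub_hurwitzTail {y : ℝ} (hy : |y| < 1) {w : ℂ} (hw : 1 < w.re) :
    HasSum (fun n : ℕ => 1 / ((n : ℂ) + 1 + y) ^ w - 1 / ((n : ℂ) + 1) ^ w) (hurwitzTail w y) := by
  have hy' : ‖(y : ℂ)‖ < 1 := by simpa using hy
  set F : ℕ × ℕ → ℂ := fun p => Ring.choose (-w) (p.1 + 1) * (y : ℂ) ^ (p.1 + 1) *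
      (1 / ((p.2 : ℂ) + 1) ^ (w + p.1 + 1)) with hF
  have hsn : Summable fun n : ℕ => ‖1 / ((n : ℂ) + 1) ^ w‖ := by
    have := (summable_nat_add_iff 1).2 (Complex.summable_one_div_nat_cpow.2 hw).norm
    simpa using this
  have hsj : Summable fun j : ℕ => ‖Ring.choose (-w) (j + 1) * (y : ℂ) ^ (j + 1)‖ := by
    obtain ⟨R, hR⟩ := exists_nat_ge ‖w‖
    refine (summable_nat_add_iff 1 (f := fun j => ‖Ring.choose (-w) j * (y : ℂ) ^ j‖)).2 ?_
    refine Summable.of_nonneg_of_le (fun _ => norm_nonneg _) (fun j => ?_)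
      (summable_choose_mul_geometric_of_norm_lt_one R (r := |y|) (by simpa using hy))
    rw [norm_mul, norm_pow, Complex.norm_real, Real.norm_eq_abs]
    gcongr
    exact norm_choose_neg_le hR j
  have hFs : Summable F := by
    refine Summable.of_norm_bounded (hsj.mul_of_nonneg hsn (fun _ => norm_nonneg _)
      (fun _ => norm_nonneg _)) fun p => ?_
    simp only [hF]
    rw [norm_mul]
    gcongr
    rw [norm_div, norm_div, ← Nat.cast_succ, Complex.norm_natCast_cpow_of_pos p.2.succ_pos,
      Complex.norm_natCast_cpow_of_pos p.2.succ_pos]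
    refine div_le_div_of_nonneg_left (by simp) (by positivity) ?_
    refine Real.rpow_le_rpow_of_exponent_le (Nat.one_le_cast.2 p.2.succ_pos) ?_
    simp only [add_re, natCast_re, one_re]
    linarith [(Nat.cast_nonneg p.1 : (0 : ℝ) ≤ p.1)]
  have hrow : ∀ j : ℕ, HasSum (fun n => F (j, n)) (tailCoeff w j * (y : ℂ) ^ (j + 1)) := fun j => by
    have hre : 1 < (w + j + 1).re := by
      simp only [add_re, natCast_re, one_re]
      linarith [(Nat.cast_nonneg j : (0 : ℝ) ≤ j)]
    have hne : w + j + 1 ≠ 1 := fun h => by rw [h] at hre; norm_num at hre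
    convert! (hasSum_riemannZeta hre).mul_left (Ring.choose (-w) (j + 1) * (y : ℂ) ^ (j + 1)) using 1
    rw [tailCoeff, zetaReg_of_ne hne]
    have hj : ((j : ℂ) + 1) ≠ 0 := Nat.cast_add_one_ne_zero j
    have := succ_mul_choose_succ (-w) j
    field_simp
    linear_combination -riemannZeta (w + j + 1) * (y : ℂ) ^ (j + 1) * this
  have h1 : HasSum F (hurwitzTail w y) := by
    have := hFs.hasSum.prod_fiberwise hrow
    rw [(hasSum_hurwitzTail w hy').unique this]
    exact hFs.hasSum
  have h2 : HasSum (F ∘ (Equiv.prodComm ℕ ℕ)) (hurwitzTail w y) :=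
    (Equiv.hasSum_iff (Equiv.prodComm ℕ ℕ)).2 h1
  exact h2.prod_fiberwise fun n => one_div_add_cpow_sub_hasSum hy w n

/-- Two entire functions that agree for `Re w > 1` are equal. -/
lemma eq_of_eqOn_one_lt_re {f g : ℂ → ℂ} (hf : Differentiable ℂ f) (hg : Differentiable ℂ g)
    (h : ∀ w : ℂ, 1 < w.re → f w = g w) : f = g := by
  refine AnalyticOnNhd.eq_of_eventuallyEq (z₀ := 2) (fun z _ => hf.analyticAt z)
    (fun z _ => hg.analyticAt z) ?_
  filter_upwards [(isOpen_lt continuous_const Complex.continuous_re).mem_nhds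
    (show (1 : ℝ) < (2 : ℂ).re by simp)] with w hw using h w hw

/-- The term `n = 0` of the Hurwitz series is the whole singularity at `x = 0`. Both sides minus
`ζ(w)` are entire in `w`, so the comparison for `Re w > 1` reaches every `w`, including `w = 1`. -/
lemma hurwitzZeta_eq {x : ℝ} (h0 : 0 < x) (h1 : x < 1) (w : ℂ) :
    hurwitzZeta (x : UnitAddCircle) w = (x : ℂ) ^ (-w) + riemannZeta w + hurwitzTail w x := by
  have hx : |x| < 1 := abs_lt.2 ⟨by linarith, h1⟩
  have hx0 : (x : ℂ) ≠ 0 := by exact_mod_cast h0.ne'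
  suffices h : (fun w => hurwitzZeta (x : UnitAddCircle) w - hurwitzZeta 0 w) =
      fun w => (x : ℂ) ^ (-w) + hurwitzTail w x by
    have := congrFun h w
    simp only [hurwitzZeta_zero] at this
    linear_combination this
  refine eq_of_eqOn_one_lt_re (differentiable_hurwitzZeta_sub_hurwitzZeta _ _) ?_ fun w hw => ?_
  · refine Differentiable.add (fun w => ?_) (differentiable_hurwitzTail (by simpa using hx))
    exact differentiableAt_id.neg.const_cpow (Or.inl hx0)
  · have ha := hasSum_hurwitzZeta_of_one_lt_re (a := x) ⟨h0.le, h1.le⟩ hw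
    rw [← hasSum_nat_add_iff' 1] at ha
    have hb := (hasSum_sub_hurwitzTail hx hw).add (hasSum_riemannZeta hw)
    have := ha.unique (hb.congr_fun fun n => ?_)
    · rw [hurwitzZeta_zero, Complex.cpow_neg]
      simp only [Finset.sum_range_one, Nat.cast_zero, zero_add, one_div] at this
      linear_combination this
    · push_cast
      ring

lemma hurwitzZeta_one_sub_eq {x : ℝ} (h0 : 0 < x) (h1 : x < 1) (w : ℂ) :
    hurwitzZeta ((1 - x : ℝ) : UnitAddCircle) w = riemannZeta w + hurwitzTail w (-x) := by
  have hx : |-x| < 1 := abs_lt.2 ⟨by linarith, by linarith⟩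
  suffices h : (fun w => hurwitzZeta ((1 - x : ℝ) : UnitAddCircle) w - hurwitzZeta 0 w) =
      fun w => hurwitzTail w (-x : ℝ) by
    have := congrFun h w
    simp only [hurwitzZeta_zero] at this
    push_cast at this
    linear_combination this
  refine eq_of_eqOn_one_lt_re (differentiable_hurwitzZeta_sub_hurwitzZeta _ _)
    (differentiable_hurwitzTail (by simpa using hx)) fun w hw => ?_
  have ha := hasSum_hurwitzZeta_of_one_lt_re (a := 1 - x) ⟨by linarith, by linarith⟩ hw
  have hb := (hasSum_sub_hurwitzTail hx hw).add (hasSum_riemannZeta hw)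
  have := ha.unique (hb.congr_fun fun n => ?_)
  · rw [hurwitzZeta_zero]
    linear_combination this
  · push_cast
    ring_nf

/-! ### Distribution relations -/

/-- For `Re w > 1`, split the series of `ζ(w, θ)` into residue classes modulo `n`: `j + nm + θ = n
(m + (j + θ)/n)`. The identity then continues analytically over the connected set `{1}ᶜ`. -/
lemma sum_hurwitzZeta {θ : ℝ} (h0 : 0 < θ) (h1 : θ < 1) {n : ℕ} (hn : 0 < n) {w : ℂ} (hw : w ≠ 1) :
    ∑ j ∈ Finset.range n, hurwitzZeta (((j + θ) / n : ℝ) : UnitAddCircle) w =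
      (n : ℂ) ^ w * hurwitzZeta (θ : UnitAddCircle) w := by
  have hn0 : (n : ℂ) ≠ 0 := by exact_mod_cast hn.ne'
  have hnr : (0 : ℝ) < n := by exact_mod_cast hn
  have hopen : IsOpen ({1}ᶜ : Set ℂ) := isOpen_compl_singleton
  have hconn : IsPreconnected ({1}ᶜ : Set ℂ) :=
    (isConnected_compl_singleton_of_one_lt_rank (by simp) 1).isPreconnected
  have hL : DifferentiableOn ℂ (fun w => ∑ j ∈ Finset.range n,
      hurwitzZeta (((j + θ) / n : ℝ) : UnitAddCircle) w) {1}ᶜ := by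
    refine DifferentiableOn.fun_sum fun j _ w hw => ?_
    exact (differentiableAt_hurwitzZeta _ hw).differentiableWithinAt
  have hR : DifferentiableOn ℂ (fun w => (n : ℂ) ^ w * hurwitzZeta (θ : UnitAddCircle) w)
      {1}ᶜ := fun w hw =>
    ((differentiableAt_id.const_cpow (Or.inl hn0)).mul
      (differentiableAt_hurwitzZeta _ hw)).differentiableWithinAt
  refine (hL.analyticOnNhd hopen).eqOn_of_preconnected_of_eventuallyEq
    (hR.analyticOnNhd hopen) hconn (z₀ := 2) (by simp) ?_ hw
  filter_upwards [(isOpen_lt continuous_const Complex.continuous_re).mem_nhds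
    (show (1 : ℝ) < (2 : ℂ).re by simp)] with w hw
  have hθ := hasSum_hurwitzZeta_of_one_lt_re (a := θ) ⟨h0.le, h1.le⟩ hw
  have : NeZero n := ⟨hn.ne'⟩
  rw [← hθ.tsum_eq, Nat.sumByResidueClasses hθ.summable n, Finset.mul_sum,
    Finset.sum_range (n := n)
      (fun j => hurwitzZeta (((j + θ) / n : ℝ) : UnitAddCircle) w)]
  obtain ⟨N, rfl⟩ : ∃ N, n = N + 1 := ⟨n - 1, by omega⟩
  refine Finset.sum_congr rfl fun j _ => ?_
  have hj : (j : ℝ) + 1 ≤ (N + 1 : ℕ) := by exact_mod_cast j.2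
  have ha := hasSum_hurwitzZeta_of_one_lt_re (a := ((j : ℕ) + θ) / (N + 1 : ℕ))
    ⟨by positivity, by rw [div_le_one hnr]; linarith⟩ hw
  rw [← ha.tsum_eq, ← tsum_mul_left]
  refine tsum_congr fun m => ?_
  have hb : (0 : ℝ) ≤ m + ((j : ℕ) + θ) / (N + 1 : ℕ) := by positivity
  have hmul := Complex.mul_cpow_ofReal_nonneg hnr.le hb w
  have hA : ((N + 1 : ℕ) : ℂ) ^ w ≠ 0 := fun h => hn0 ((Complex.cpow_eq_zero_iff _ _).1 h).1
  have he : (((ZMod.val (n := N + 1) j + (N + 1) * m : ℕ) : ℂ) + θ) =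
      (((N + 1 : ℕ) : ℝ) : ℂ) * ((m + ((j : ℕ) + θ) / (N + 1 : ℕ) : ℝ) : ℂ) := by
    have : ZMod.val (n := N + 1) j = (j : ℕ) := rfl
    rw [this]
    push_cast at hn0 ⊢
    field_simp
    ring
  rw [he, hmul]
  push_cast at hA ⊢
  field_simp

lemma sum_hurwitzZeta_one_sub {θ : ℝ} (h0 : 0 < θ) (h1 : θ < 1) {n : ℕ} (hn : 0 < n) {w : ℂ}
    (hw : w ≠ 1) :
    ∑ j ∈ Finset.range n, hurwitzZeta ((1 - (j + θ) / n : ℝ) : UnitAddCircle) w =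
      (n : ℂ) ^ w * hurwitzZeta ((1 - θ : ℝ) : UnitAddCircle) w := by
  -- Under `j ↦ n - 1 - j`, the point `1 - (j + θ)/n` becomes `(j + (1 - θ))/n`.
  rw [← sum_hurwitzZeta (θ := 1 - θ) (by linarith) (by linarith) hn hw,
    ← Finset.sum_range_reflect]
  refine Finset.sum_congr rfl fun j hj => ?_
  congr 2
  have hj' := Finset.mem_range.1 hj
  have hnr : (n : ℝ) ≠ 0 := by exact_mod_cast hn.ne'
  rw [Nat.cast_sub (by omega), Nat.cast_sub (by omega)]
  push_cast
  field_simp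
  ring

lemma sum_circleZeta {θ : ℝ} (h0 : 0 < θ) (h1 : θ < 1) {n : ℕ} (hn : 0 < n) {s : ℂ}
    (hs : s ≠ 1 / 2) :
    ∑ j ∈ Finset.range n, circleZeta s ((j + θ) / n) = (n : ℂ) ^ (2 * s) * circleZeta s θ := by
  have hw : 2 * s ≠ 1 := fun h => hs (by linear_combination h / 2)
  simp only [circleZeta]
  rw [← Finset.mul_sum, Finset.sum_add_distrib, sum_hurwitzZeta h0 h1 hn hw,
    sum_hurwitzZeta_one_sub h0 h1 hn hw]
  ring

lemma sum_circleZetaDeriv {θ : ℝ} (h0 : 0 < θ) (h1 : θ < 1) {n : ℕ} (hn : 0 < n) (s : ℂ) :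
    ∑ j ∈ Finset.range n, circleZetaDeriv s ((j + θ) / n) =
      (n : ℂ) ^ (2 * s) * n * circleZetaDeriv s θ := by
  by_cases hs : s = 0
  -- Here the exponent `1 + 2s` is the pole excluded from the distribution relation, but the factor
  -- `-2s` kills both sides.
  · simp [circleZetaDeriv, hs]
  have hn0 : (n : ℂ) ≠ 0 := by exact_mod_cast hn.ne'
  have hw : 1 + 2 * s ≠ 1 := fun h => hs (by linear_combination h / 2)
  simp only [circleZetaDeriv]
  rw [← Finset.mul_sum, Finset.sum_sub_distrib, sum_hurwitzZeta h0 h1 hn hw,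
    sum_hurwitzZeta_one_sub h0 h1 hn hw, Complex.cpow_add _ _ hn0, Complex.cpow_one]
  ring

/-! ### Local form of the circle zeta function -/

lemma circleZeta_eq {x : ℝ} (h0 : 0 < x) (h1 : x < 1) (s : ℂ) :
    circleZeta s x = ((2 * Real.pi : ℝ) : ℂ) ^ (-2 * s) * ((x : ℂ) ^ (-2 * s) +
      (2 * riemannZeta (2 * s) + hurwitzTail (2 * s) x + hurwitzTail (2 * s) (-x))) := by
  rw [circleZeta, hurwitzZeta_eq h0 h1, hurwitzZeta_one_sub_eq h0 h1, neg_mul]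
  ring

lemma circleZetaDeriv_eq {x : ℝ} (h0 : 0 < x) (h1 : x < 1) (s : ℂ) :
    circleZetaDeriv s x = -2 * s * ((2 * Real.pi : ℝ) : ℂ) ^ (-2 * s) * ((x : ℂ) ^ (-2 * s - 1) +
      (hurwitzTail (1 + 2 * s) x - hurwitzTail (1 + 2 * s) (-x))) := by
  rw [circleZetaDeriv, hurwitzZeta_eq h0 h1, hurwitzZeta_one_sub_eq h0 h1,
    show -(1 + 2 * s) = -2 * s - 1 by ring]
  ring

lemma hasDerivAt_hurwitzTail_add (w : ℂ) {x : ℂ} (hx : ‖x‖ < 1) :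
    HasDerivAt (fun x => hurwitzTail w x + hurwitzTail w (-x))
      (-w * (hurwitzTail (1 + w) x - hurwitzTail (1 + w) (-x))) x := by
  have h1 := hasDerivAt_hurwitzTail w hx
  have h2 := (hasDerivAt_hurwitzTail w (z := -x) (by simpa using hx)).comp x (hasDerivAt_neg x)
  rw [add_comm 1 w]
  refine (h1.add h2).congr_deriv ?_
  ring

/-- This supplies a primitive, up to the factor `1 - w`, of the regular part of the circle zeta
function. -/
lemma hasDerivAt_hurwitzTail_sub {w : ℂ} (hw : w ≠ 1) {x : ℂ} (hx : ‖x‖ < 1) :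
    HasDerivAt (fun x => hurwitzTail (w - 1) x - hurwitzTail (w - 1) (-x))
      ((1 - w) * (2 * riemannZeta w + hurwitzTail w x + hurwitzTail w (-x))) x := by
  have h1 := hasDerivAt_hurwitzTail (w - 1) hx
  have h2 := (hasDerivAt_hurwitzTail (w - 1) (z := -x) (by simpa using hx)).comp x
    (hasDerivAt_neg x)
  refine (h1.sub h2).congr_deriv ?_
  rw [sub_add_cancel, zetaReg_of_ne hw]
  ring

lemma hasDerivAt_ofReal_cpow_of_pos {x : ℝ} (hx : 0 < x) (a : ℂ) :
    HasDerivAt (fun x : ℝ => (x : ℂ) ^ a) (a * (x : ℂ) ^ (a - 1)) x := by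
  have h := (hasDerivAt_id (x : ℂ)).cpow_const (c := a) (Or.inl (by simpa using hx))
  simpa using h.comp_ofReal

lemma hasDerivAt_circleZeta {x : ℝ} (h0 : 0 < x) (h1 : x < 1) (s : ℂ) :
    HasDerivAt (fun t : ℝ => circleZeta s t) (circleZetaDeriv s x) x := by
  have hx : ‖(x : ℂ)‖ < 1 := by simpa using abs_lt.2 ⟨by linarith, h1⟩
  have hE := ((hasDerivAt_hurwitzTail_add (2 * s) hx).comp_ofReal)
  have hP := hasDerivAt_ofReal_cpow_of_pos h0 (-2 * s)
  have hd := ((hP.add (hE.const_add (2 * riemannZeta (2 * s)))).const_mul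
    (((2 * Real.pi : ℝ) : ℂ) ^ (-2 * s)))
  rw [circleZetaDeriv_eq h0 h1]
  refine (hd.congr_deriv ?_).congr_of_eventuallyEq ?_
  · ring
  · filter_upwards [isOpen_Ioo.mem_nhds (show x ∈ Set.Ioo 0 1 from ⟨h0, h1⟩)] with t ht
    rw [circleZeta_eq ht.1 ht.2]
    simp only [Pi.add_apply]
    ring

lemma differentiable_circleZetaDeriv (θ : ℝ) :
    Differentiable ℂ (fun s : ℂ => circleZetaDeriv s θ) := by
  have hd : Differentiable ℂ fun s : ℂ => hurwitzZeta (θ : UnitAddCircle) (1 + 2 * s) -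
      hurwitzZeta ((1 - θ : ℝ) : UnitAddCircle) (1 + 2 * s) :=
    (differentiable_hurwitzZeta_sub_hurwitzZeta (θ : UnitAddCircle)
      ((1 - θ : ℝ) : UnitAddCircle)).comp (by fun_prop : Differentiable ℂ fun s : ℂ => 1 + 2 * s)
  have hpi : ((2 * Real.pi : ℝ) : ℂ) ≠ 0 := by exact_mod_cast Real.two_pi_pos.ne'
  have hc : Differentiable ℂ fun s : ℂ => ((2 * Real.pi : ℝ) : ℂ) ^ (-2 * s) := fun s =>
    (differentiableAt_id.const_mul (-2 : ℂ)).const_cpow (Or.inl hpi)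
  unfold circleZetaDeriv
  exact ((differentiable_id.const_mul (-2 : ℂ)).mul hc).mul hd

/-! ### Riemann sums of smooth periodic functions -/

lemma div_mem_Icc_of_lt {n j : ℕ} (hj : j < n) {θ : ℝ} (hθ : θ ∈ Set.Icc (0 : ℝ) 1) :
    ((j : ℝ) + θ) / n ∈ Set.Icc (0 : ℝ) 1 := by
  have hn : (0 : ℝ) < n := by exact_mod_cast (Nat.zero_le j).trans_lt hj
  have hj' : (j : ℝ) + 1 ≤ n := by exact_mod_cast hj
  refine ⟨div_nonneg (add_nonneg (Nat.cast_nonneg j) hθ.1) hn.le, ?_⟩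
  rw [div_le_one hn]
  linarith [hθ.2]

lemma div_mem_Ioo_of_lt {n j : ℕ} (hj : j < n) {θ : ℝ} (h0 : 0 < θ) (h1 : θ < 1) :
    ((j : ℝ) + θ) / n ∈ Set.Ioo (0 : ℝ) 1 := by
  have hn : (0 : ℝ) < n := by exact_mod_cast (Nat.zero_le j).trans_lt hj
  have hj' : (j : ℝ) + 1 ≤ n := by exact_mod_cast hj
  refine ⟨by positivity, ?_⟩
  rw [div_lt_one hn]
  linarith

lemma integral_sum_comp_div {g : ℝ → ℂ} (hg : Continuous g) {n : ℕ} (hn : 0 < n) :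
    ∫ t in (0 : ℝ)..1, ∑ j ∈ Finset.range n, g ((j + t) / n) = n * ∫ t in (0 : ℝ)..1, g t := by
  have hnr : (n : ℝ) ≠ 0 := by exact_mod_cast hn.ne'
  rw [intervalIntegral.integral_finsetSum fun j _ =>
    (Continuous.intervalIntegrable (by fun_prop) _ _)]
  have h1 : ∀ j : ℕ, ∫ t in (0 : ℝ)..1, g ((j + t) / n) =
      (n : ℝ) • ∫ t in ((j : ℕ) : ℝ) / n..((j + 1 : ℕ) : ℝ) / n, g t := fun j => by
    have := intervalIntegral.integral_comp_add_div (a := 0) (b := 1) g hnr ((j : ℝ) / n)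
    rw [zero_div, add_zero] at this
    rw [show ((j + 1 : ℕ) : ℝ) / n = j / n + 1 / n by push_cast; ring, ← this]
    congr 1
    ext t
    rw [add_div]
  simp only [h1]
  rw [← Finset.smul_sum, intervalIntegral.sum_integral_adjacent_intervals
    (a := fun j : ℕ => (j : ℝ) / n) fun j _ => hg.intervalIntegrable _ _]
  simp [hnr]

/-- Riemann sums of a smooth periodic function converge faster than any power allowed by its
smoothness. -/
lemma exists_norm_sum_sub_integral_le (L : ℕ) : ∀ g : ℝ → ℂ, Function.Periodic g 1 →
    ContDiff ℝ L g → ∃ C : ℝ, ∀ n : ℕ, 0 < n → ∀ θ ∈ Set.Icc (0 : ℝ) 1,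
      ‖∑ j ∈ Finset.range n, g ((j + θ) / n) - n * ∫ t in (0 : ℝ)..1, g t‖ ≤ C * n / (n : ℝ) ^ L := by
  induction L with
  | zero =>
    intro g _ hg
    obtain ⟨B, hB⟩ := isCompact_Icc.exists_bound_of_continuousOn
      (hg.continuous.continuousOn (s := Set.Icc (0 : ℝ) 1))
    refine ⟨B + B, fun n hn θ hθ => ?_⟩
    rw [pow_zero, div_one, add_mul]
    refine (norm_sub_le _ _).trans (add_le_add ?_ ?_)
    · refine (norm_sum_le_of_le _ fun j hj =>
        hB _ (div_mem_Icc_of_lt (Finset.mem_range.1 hj) hθ)).trans_eq ?_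
      simp [mul_comm]
    · rw [norm_mul, Complex.norm_natCast, mul_comm]
      gcongr
      have := intervalIntegral.norm_integral_le_of_norm_le_const (a := (0 : ℝ)) (b := 1) (f := g)
        (C := B) fun t ht => hB t (by
          rw [Set.uIoc_of_le zero_le_one] at ht
          exact ⟨ht.1.le, ht.2⟩)
      simpa using this
  | succ L ih =>
    intro g hper hg
    have hg' : ContDiff ℝ ((L : WithTop ℕ∞) + 1) g := by exact_mod_cast hg
    obtain ⟨hd, -, hc⟩ := contDiff_succ_iff_deriv.1 hg'
    have hper' : Function.Periodic (deriv g) 1 := fun x => by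
      rw [← deriv_comp_add_const]
      congr 1
      exact funext hper
    obtain ⟨C, hC⟩ := ih _ hper' hc
    have hint : ∫ t in (0 : ℝ)..1, deriv g t = 0 := by
      rw [intervalIntegral.integral_deriv_eq_sub (fun x _ => hd x)
        (hc.continuous.intervalIntegrable _ _), sub_eq_zero]
      simpa using hper 0
    refine ⟨C, fun n hn θ hθ => ?_⟩
    have hnr : (0 : ℝ) < n := by exact_mod_cast hn
    -- The mean of `T` over `[0, 1]` is `n ∫ g`, so it is enough to bound the oscillation of `T`.
    -- Its derivative is `1/n` times a Riemann sum of `g'`, which has mean zero: the induction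
    -- hypothesis applies and one power of `n` is gained.
    set T : ℝ → ℂ := fun t => ∑ j ∈ Finset.range n, g ((j + t) / n) with hT
    have hTc : Continuous T := by
      have := hg.continuous
      fun_prop
    have hTd : ∀ t, HasDerivAt T (∑ j ∈ Finset.range n, (1 / n : ℝ) • deriv g ((j + t) / n)) t :=
      fun t => by
        refine HasDerivAt.fun_sum fun j _ => ?_
        refine (hd ((j + t) / n)).hasDerivAt.scomp t ?_
        exact ((hasDerivAt_id t).const_add (j : ℝ)).div_const (n : ℝ)
    have hTb : ∀ t ∈ Set.Icc (0 : ℝ) 1,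
        ‖∑ j ∈ Finset.range n, (1 / n : ℝ) • deriv g ((j + t) / n)‖ ≤ C / (n : ℝ) ^ L := by
      intro t ht
      have := hC n hn t ht
      rw [hint, mul_zero, sub_zero] at this
      rw [← Finset.smul_sum, norm_smul, Real.norm_of_nonneg (by positivity)]
      calc _ ≤ (1 / n : ℝ) * (C * n / (n : ℝ) ^ L) := by gcongr
        _ = _ := by field_simp
    have hC0 : 0 ≤ C / (n : ℝ) ^ L := (norm_nonneg _).trans (hTb 0 (by simp))
    have hTl : ∀ t ∈ Set.Icc (0 : ℝ) 1, ‖T θ - T t‖ ≤ C / (n : ℝ) ^ L := by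
      intro t ht
      have h1 := (convex_Icc (0 : ℝ) 1).norm_image_sub_le_of_norm_hasDerivWithin_le
        (fun x _ => (hTd x).hasDerivWithinAt) hTb ht hθ
      refine h1.trans (mul_le_of_le_one_right hC0 ?_)
      rw [Real.norm_eq_abs, abs_le]
      constructor <;> linarith [ht.1, ht.2, hθ.1, hθ.2]
    have hsub : T θ - n * ∫ t in (0 : ℝ)..1, g t = ∫ t in (0 : ℝ)..1, (T θ - T t) := by
      rw [intervalIntegral.integral_sub (by simp) (hTc.intervalIntegrable _ _), hT,
        integral_sum_comp_div hg.continuous hn]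
      simp
    rw [hsub]
    have := intervalIntegral.norm_integral_le_of_norm_le_const (a := (0 : ℝ)) (b := 1)
      (f := fun t => T θ - T t) (C := C / (n : ℝ) ^ L) fun t ht => hTl t (by
        rw [Set.uIoc_of_le zero_le_one] at ht
        exact ⟨ht.1.le, ht.2⟩)
    refine this.trans_eq ?_
    rw [sub_zero, abs_one, mul_one, pow_succ]
    field_simp

/-! ### Complex powers of the absolute value -/

lemma norm_abs_cpow (y : ℝ) {μ : ℂ} (hμ : 0 < μ.re) : ‖((|y| : ℝ) : ℂ) ^ μ‖ = |y| ^ μ.re := by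
  rcases (abs_nonneg y).eq_or_lt with h | h
  · rw [← h, Real.zero_rpow hμ.ne', Complex.ofReal_zero, Complex.zero_cpow, norm_zero]
    rintro rfl
    simp at hμ
  · exact Complex.norm_cpow_eq_rpow_re_of_pos h μ

lemma hasDerivAt_abs_cpow {μ : ℂ} (hμ : 2 < μ.re) (y : ℝ) :
    HasDerivAt (fun y : ℝ => ((|y| : ℝ) : ℂ) ^ μ) (μ * y * ((|y| : ℝ) : ℂ) ^ (μ - 2)) y := by
  rcases lt_trichotomy y 0 with hy | rfl | hy
  · have h := (hasDerivAt_ofReal_cpow_of_pos (neg_pos.2 hy) μ).scomp y (hasDerivAt_neg y)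
    refine (h.congr_deriv ?_).congr_of_eventuallyEq ?_
    · have hne : ((-y : ℝ) : ℂ) ≠ 0 := by exact_mod_cast (neg_pos.2 hy).ne'
      rw [abs_of_neg hy, show μ - 1 = μ - 2 + 1 by ring, Complex.cpow_add _ _ hne, Complex.cpow_one]
      push_cast
      simp
      ring
    · filter_upwards [isOpen_Iio.mem_nhds hy] with t ht
      simp [abs_of_neg (Set.mem_Iio.1 ht)]
  · rw [Complex.ofReal_zero, mul_zero, zero_mul]
    -- A function that is `O(y²)` at the origin has derivative zero there.
    have hO : (fun y : ℝ => ((|y| : ℝ) : ℂ) ^ μ) =O[𝓝 0] fun y => ‖y - 0‖ ^ 2 := by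
      refine IsBigO.of_bound 1 ?_
      filter_upwards [Metric.ball_mem_nhds (0 : ℝ) one_pos] with y hy
      rw [norm_abs_cpow y (by linarith), sub_zero, one_mul, norm_pow, norm_norm, Real.norm_eq_abs,
        ← Real.rpow_natCast]
      exact Real.rpow_le_rpow_of_exponent_ge_of_imp (abs_nonneg y) (by simpa using (mem_ball_zero_iff.1 hy).le)
        (by simpa using hμ.le) (by intro _ h; linarith)
    exact (hO.hasFDerivAt one_lt_two).hasDerivAt
  · refine ((hasDerivAt_ofReal_cpow_of_pos hy μ).congr_deriv ?_).congr_of_eventuallyEq ?_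
    · have hne : (y : ℂ) ≠ 0 := by exact_mod_cast hy.ne'
      rw [abs_of_pos hy, show μ - 1 = μ - 2 + 1 by ring, Complex.cpow_add _ _ hne, Complex.cpow_one]
      ring
    · filter_upwards [isOpen_Ioi.mem_nhds hy] with t ht
      simp [abs_of_pos (Set.mem_Ioi.1 ht)]

/-- The derivative is the smooth factor `μ y` times `|y|^(μ - 2)`, so the induction spends `2` of
the exponent per derivative. This is wasteful but harmless, as `M` can be taken large. -/
lemma contDiff_abs_cpow (L : ℕ) : ∀ μ : ℂ, 2 * L < μ.re →
    ContDiff ℝ L (fun y : ℝ => ((|y| : ℝ) : ℂ) ^ μ) := by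
  induction L with
  | zero =>
    intro μ hμ
    rw [Nat.cast_zero, contDiff_zero]
    exact (Complex.continuous_ofReal_cpow_const (by simpa using hμ)).comp continuous_abs
  | succ L ih =>
    intro μ hμ
    push_cast at hμ ⊢
    have hL : (0 : ℝ) ≤ L := Nat.cast_nonneg L
    have hd := hasDerivAt_abs_cpow (show 2 < μ.re by linarith)
    refine contDiff_succ_iff_deriv.2 ⟨fun y => (hd y).differentiableAt, by simp, ?_⟩
    rw [funext fun y => (hd y).deriv]
    have := ih (μ - 2) (by simp; linarith)
    exact (contDiff_const.mul Complex.ofRealCLM.contDiff).mul this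

/-! ### Periodic extension -/

/-- Periodize through the fractional part. On the interval of radius `1` about an integer `k` the
result is `g₀ (x - k)`, on both sides of `k`, so smoothness across `k` is that of `g₀` at `0`. -/
lemma exists_periodic_extension {L : ℕ} {g₀ : ℝ → ℂ} (hc : ContDiffOn ℝ L g₀ (Set.Ioo (-1) 1))
    (h : ∀ x ∈ Set.Ioo (0 : ℝ) 1, g₀ (x - 1) = g₀ x) :
    ∃ g : ℝ → ℂ, Function.Periodic g 1 ∧ ContDiff ℝ L g ∧ ∀ x ∈ Set.Ico (0 : ℝ) 1, g x = g₀ x := by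
  have key : ∀ (k : ℤ) (x : ℝ), (k : ℝ) - 1 < x → x < k + 1 → g₀ (Int.fract x) = g₀ (x - k) := by
    intro k x h1 h2
    rcases lt_or_ge x k with hx | hx
    · have hf : ⌊x⌋ = k - 1 := Int.floor_eq_iff.2 ⟨by push_cast; linarith, by push_cast; linarith⟩
      have : Int.fract x = x - k + 1 := by rw [← Int.self_sub_floor, hf]; push_cast; ring
      rw [this, ← h (x - k + 1) ⟨by linarith, by linarith⟩, add_sub_cancel_right]
    · have hf : ⌊x⌋ = k := Int.floor_eq_iff.2 ⟨hx, h2⟩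
      rw [← Int.self_sub_floor, hf]
  refine ⟨fun x => g₀ (Int.fract x), fun x => by simp, ?_, fun x hx => ?_⟩
  · refine contDiff_iff_contDiffAt.2 fun x => ?_
    have h1 := Int.floor_le x
    have h2 := Int.lt_floor_add_one x
    have hat : ContDiffAt ℝ L (fun y => g₀ (y - ⌊x⌋)) x := by
      refine ContDiffAt.comp x (g := g₀) ?_ (by fun_prop)
      exact hc.contDiffAt (isOpen_Ioo.mem_nhds ⟨by linarith, by linarith⟩)
    refine hat.congr_of_eventuallyEq ?_
    filter_upwards [isOpen_Ioo.mem_nhds (show x ∈ Set.Ioo ((⌊x⌋ : ℝ) - 1) (⌊x⌋ + 1) from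
      ⟨by linarith, h2⟩)] with y hy using key _ y hy.1 hy.2
  · simp only
    rw [Int.fract_eq_self.2 hx]

lemma contDiffOn_comp_ofReal {L : ℕ} {f : ℂ → ℂ} {r : ℝ}
    (hf : DifferentiableOn ℂ f (Metric.ball 0 r)) :
    ContDiffOn ℝ L (fun x : ℝ => f x) (Set.Ioo (-r) r) := by
  have h1 : ContDiffOn ℝ L f (Metric.ball 0 r) :=
    (hf.contDiffOn Metric.isOpen_ball).restrict_scalars ℝ
  refine h1.comp Complex.ofRealCLM.contDiff.contDiffOn fun x hx => ?_
  simpa using abs_lt.2 hx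

/-! ### The function `(z / 2) / sin (z / 2)` and its powers -/

/-- The function `(z / 2) / sin (z / 2)`, with value `1` at `z = 0`. -/
def sincInv (z : ℂ) : ℂ := if z = 0 then 1 else z / 2 / Complex.sin (z / 2)

lemma taylorCoeff_eq (k : ℕ) (s : ℂ) :
    taylorCoeff k s = iteratedDeriv (2 * k) (fun z => sincInv z ^ (2 * s)) 0 /
      ((2 * k).factorial : ℂ) := rfl

lemma sincInv_neg (z : ℂ) : sincInv (-z) = sincInv z := by
  simp only [sincInv, neg_eq_zero]
  rw [neg_div, Complex.sin_neg, neg_div_neg_eq]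

lemma mul_sin_pos {a : ℝ} (h0 : a ≠ 0) (h : |a| < Real.pi) : 0 < a * Real.sin a := by
  obtain ⟨h1, h2⟩ := abs_lt.1 h
  rcases lt_or_gt_of_ne h0 with ha | ha
  · exact mul_pos_of_neg_of_neg ha (Real.sin_neg_of_neg_of_neg_pi_lt ha h1)
  · exact mul_pos ha (Real.sin_pos_of_pos_of_lt_pi ha h2)

lemma sin_ne_zero_of_abs_re_lt {u : ℂ} (hu : u ≠ 0) (h : |u.re| < Real.pi) :
    Complex.sin u ≠ 0 := by
  intro hs
  obtain ⟨k, hk⟩ := Complex.sin_eq_zero_iff.1 hs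
  have hre : u.re = k * Real.pi := by rw [hk]; simp
  rw [hre, abs_mul, abs_of_pos Real.pi_pos] at h
  have h1 : |(k : ℝ)| < 1 := by
    by_contra hc
    nlinarith [Real.pi_pos]
  have hk0 : k = 0 := by
    have : |k| < 1 := by exact_mod_cast h1
    exact Int.abs_lt_one_iff.1 this
  exact hu (by rw [hk, hk0]; simp)

/-- Suppose `u = q sin u` with `u = z/2` and `q ≤ 0` real. The real parts are incompatible because
`Re u · sin (Re u) > 0`, or, if `Re u = 0`, the imaginary parts because `Im u · sinh (Im u) ≥ 0`.
Hence principal powers of `sincInv` are holomorphic on the disc of radius `2π`. -/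
lemma sincInv_mem_slitPlane {z : ℂ} (hz : |z.re| < 2 * Real.pi) : sincInv z ∈ slitPlane := by
  unfold sincInv
  split_ifs with h
  · exact Complex.one_mem_slitPlane
  set u := z / 2 with hu
  have hu0 : u ≠ 0 := div_ne_zero h two_ne_zero
  have hur : u.re = z.re / 2 := by rw [hu]; simp
  have hre : |u.re| < Real.pi := by
    rw [hur, abs_div, abs_two]
    linarith
  have hs := sin_ne_zero_of_abs_re_lt hu0 hre
  rw [Complex.mem_slitPlane_iff]
  by_contra hcon
  push Not at hcon
  obtain ⟨hq1, hq2⟩ := hcon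
  set q := u / Complex.sin u with hq
  have hqr : q = (q.re : ℂ) := by apply Complex.ext <;> simp [hq2]
  have hmul : u = (q.re : ℂ) * Complex.sin u := by
    rw [← hqr, hq, div_mul_cancel₀ _ hs]
  have e1 : u.re = q.re * (Real.sin u.re * Real.cosh u.im) := by
    have := congrArg Complex.re hmul
    rwa [Complex.re_ofReal_mul, Complex.sin_eq, Complex.add_re, ← Complex.ofReal_sin,
      ← Complex.ofReal_cosh, ← Complex.ofReal_cos, ← Complex.ofReal_sinh, ← Complex.ofReal_mul,
      ← Complex.ofReal_mul, Complex.ofReal_re, Complex.re_ofReal_mul, Complex.I_re, mul_zero,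
      add_zero] at this
  have e2 : u.im = q.re * (Real.cos u.re * Real.sinh u.im) := by
    have := congrArg Complex.im hmul
    rwa [Complex.im_ofReal_mul, Complex.sin_eq, Complex.add_im, ← Complex.ofReal_sin,
      ← Complex.ofReal_cosh, ← Complex.ofReal_cos, ← Complex.ofReal_sinh, ← Complex.ofReal_mul,
      ← Complex.ofReal_mul, Complex.ofReal_im, Complex.im_ofReal_mul, Complex.I_im, mul_one,
      zero_add] at this
  by_cases ha : u.re = 0
  · rw [ha, Real.cos_zero, one_mul] at e2
    have hb : u.im ≠ 0 := fun hb => hu0 (Complex.ext ha hb)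
    have hpos : 0 ≤ u.im * Real.sinh u.im := by
      rcases le_total 0 u.im with hb' | hb'
      · exact mul_nonneg hb' (Real.sinh_nonneg_iff.2 hb')
      · exact mul_nonneg_of_nonpos_of_nonpos hb' (Real.sinh_nonpos_iff.2 hb')
    have : u.im * u.im = q.re * (u.im * Real.sinh u.im) := by linear_combination u.im * e2
    have h2 : 0 < u.im * u.im := mul_self_pos.2 hb
    nlinarith [mul_nonneg (neg_nonneg.2 hq1) hpos]
  · have hpos := mul_pos (mul_sin_pos ha hre) (Real.cosh_pos u.im)
    have : u.re * u.re = q.re * (u.re * Real.sin u.re * Real.cosh u.im) := by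
      linear_combination u.re * e1
    have h2 : 0 < u.re * u.re := mul_self_pos.2 ha
    nlinarith [mul_nonneg (neg_nonneg.2 hq1) hpos.le]

lemma sincInv_eq_inv_dslope (z : ℂ) : sincInv z = (dslope Complex.sin 0 (z / 2))⁻¹ := by
  unfold sincInv
  split_ifs with h
  · simp [h, dslope_same]
  · rw [dslope_of_ne _ (div_ne_zero h two_ne_zero), slope_def_field]
    simp

lemma abs_re_lt_of_mem_ball {z : ℂ} {r : ℝ} (hz : z ∈ Metric.ball (0 : ℂ) r) : |z.re| < r :=
  (Complex.abs_re_le_norm z).trans_lt (mem_ball_zero_iff.1 hz)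

lemma differentiableOn_sincInv :
    DifferentiableOn ℂ sincInv (Metric.ball 0 (2 * Real.pi)) := by
  rw [funext sincInv_eq_inv_dslope]
  have h1 : Differentiable ℂ (dslope Complex.sin 0) := by
    rw [← differentiableOn_univ]
    exact (Complex.differentiableOn_dslope univ_mem).2 Complex.differentiable_sin.differentiableOn
  refine DifferentiableOn.inv (h1.comp (by fun_prop)).differentiableOn fun z hz h0 => ?_
  have hm := sincInv_mem_slitPlane (abs_re_lt_of_mem_ball hz)
  rw [sincInv_eq_inv_dslope] at hm
  change dslope Complex.sin 0 (z / 2) = 0 at h0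
  rw [h0, inv_zero] at hm
  exact Complex.slitPlane_ne_zero hm rfl

lemma differentiableOn_sincInv_cpow (s : ℂ) :
    DifferentiableOn ℂ (fun z => sincInv z ^ (2 * s)) (Metric.ball 0 (2 * Real.pi)) :=
  differentiableOn_sincInv.cpow_const fun _ hz => sincInv_mem_slitPlane (abs_re_lt_of_mem_ball hz)

/-! ### The Taylor coefficients -/

/-- The odd Taylor coefficients vanish because `sincInv` is even. -/
lemma hasSum_taylorCoeff (s : ℂ) {z : ℂ} (hz : ‖z‖ < 2 * Real.pi) :
    HasSum (fun k : ℕ => taylorCoeff k s * z ^ (2 * k)) (sincInv z ^ (2 * s)) := by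
  have h := Complex.hasSum_taylorSeries_on_ball (differentiableOn_sincInv_cpow s)
    (mem_ball_zero_iff.2 hz)
  have hinj : Function.Injective fun k : ℕ => 2 * k := fun a b hab => by simpa using hab
  rw [← hinj.hasSum_iff] at h
  · refine h.congr_fun fun k => ?_
    simp only [Function.comp, taylorCoeff_eq, sub_zero, smul_eq_mul]
    ring
  · intro n hn
    have hodd : Odd n := by
      rw [← Nat.not_even_iff_odd]
      rintro ⟨k, hk⟩
      exact hn ⟨k, by simp only; omega⟩
    have h1 := iteratedDeriv_comp_neg n (fun z => sincInv z ^ (2 * s)) 0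
    simp only [sincInv_neg, neg_zero, hodd.neg_one_pow, neg_smul, one_smul] at h1
    have h2 : iteratedDeriv n (fun z => sincInv z ^ (2 * s)) 0 = 0 := self_eq_neg.1 h1
    rw [h2, smul_zero, smul_zero]

/-- From `f' = 2s (log sincInv)' f` and the Leibniz rule, each derivative of `f = sincInv^(2s)` at
`0` is `2s` times a combination of lower ones with coefficients free of `s`. -/
lemma differentiable_iteratedDeriv_sincInv_cpow (n : ℕ) :
    Differentiable ℂ fun s : ℂ => iteratedDeriv n (fun z => sincInv z ^ (2 * s)) 0 := by
  have hball : Metric.ball (0 : ℂ) (2 * Real.pi) ∈ 𝓝 0 := Metric.ball_mem_nhds _ Real.two_pi_pos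
  have hslit : ∀ z ∈ Metric.ball (0 : ℂ) (2 * Real.pi), sincInv z ∈ slitPlane := fun z hz =>
    sincInv_mem_slitPlane (abs_re_lt_of_mem_ball hz)
  have hlog : DifferentiableOn ℂ (fun z => Complex.log (sincInv z))
      (Metric.ball 0 (2 * Real.pi)) := differentiableOn_sincInv.clog hslit
  have hlog' : AnalyticAt ℂ (deriv fun z => Complex.log (sincInv z)) 0 :=
    (hlog.analyticAt hball).deriv
  have hder : ∀ s : ℂ, deriv (fun z => sincInv z ^ (2 * s)) =ᶠ[𝓝 0] fun z =>
      (2 * s) * (deriv (fun z => Complex.log (sincInv z)) z * sincInv z ^ (2 * s)) := by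
    intro s
    filter_upwards [hball] with z hz
    have hd := (hlog.differentiableAt (Metric.isOpen_ball.mem_nhds hz)).hasDerivAt
    have h2 := (hd.mul_const (2 * s)).cexp
    have h3 : (fun z => Complex.exp (Complex.log (sincInv z) * (2 * s))) =ᶠ[𝓝 z]
        fun z => sincInv z ^ (2 * s) := by
      filter_upwards [Metric.isOpen_ball.mem_nhds hz] with y hy
      rw [Complex.cpow_def_of_ne_zero (Complex.slitPlane_ne_zero (hslit y hy))]
    rw [← h3.deriv_eq, h2.deriv, h3.eq_of_nhds]
    ring
  induction n using Nat.strong_induction_on with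
  | _ n ih =>
    rcases n with _ | n
    · have h0 : ∀ s : ℂ, iteratedDeriv 0 (fun z => sincInv z ^ (2 * s)) 0 = 1 := fun s => by
        simp [iteratedDeriv_zero, sincInv]
      simp only [h0]
      exact differentiable_const 1
    · have hstep : ∀ s : ℂ, iteratedDeriv (n + 1) (fun z => sincInv z ^ (2 * s)) 0 =
          (2 * s) * ∑ i ∈ Finset.range (n + 1), (n.choose i : ℂ) *
            iteratedDeriv i (deriv fun z => Complex.log (sincInv z)) 0 *
            iteratedDeriv (n - i) (fun z => sincInv z ^ (2 * s)) 0 := fun s => by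
        have ha : AnalyticAt ℂ (fun z => sincInv z ^ (2 * s)) 0 :=
          (differentiableOn_sincInv_cpow s).analyticAt hball
        rw [iteratedDeriv_succ', (hder s).iteratedDeriv_eq n,
          iteratedDeriv_const_mul _ (hlog'.fun_mul ha).contDiffAt,
          iteratedDeriv_fun_mul hlog'.contDiffAt ha.contDiffAt]
      simp only [hstep]
      refine (differentiable_id.const_mul 2).mul (Differentiable.fun_sum fun i _ => ?_)
      exact (ih (n - i) (by omega)).const_mul _

lemma differentiable_taylorCoeff (k : ℕ) : Differentiable ℂ (taylorCoeff k) :=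
  (differentiable_iteratedDeriv_sincInv_cpow (2 * k)).div_const _

/-- Cauchy's estimate on the circle of radius `r`. Uniformity in `s` comes from bounding `log
sincInv` there. -/
lemma exists_norm_taylorCoeff_le (R : ℝ) {r : ℝ} (h0 : 0 < r) (hr : r < 2 * Real.pi) :
    ∃ C : ℝ, 0 ≤ C ∧ ∀ s : ℂ, ‖s‖ ≤ R → ∀ k : ℕ, ‖taylorCoeff k s‖ ≤ C / r ^ (2 * k) := by
  have hsub : ∀ z : ℂ, ‖z‖ ≤ r → z ∈ Metric.ball (0 : ℂ) (2 * Real.pi) := fun z hz =>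
    mem_ball_zero_iff.2 (hz.trans_lt hr)
  have hslit : ∀ z : ℂ, ‖z‖ ≤ r → sincInv z ∈ slitPlane := fun z hz =>
    sincInv_mem_slitPlane (abs_re_lt_of_mem_ball (hsub z hz))
  have hsub' : Metric.closedBall (0 : ℂ) r ⊆ Metric.ball 0 (2 * Real.pi) := fun z hz =>
    hsub z (mem_closedBall_zero_iff.1 hz)
  obtain ⟨D, hD⟩ := (isCompact_closedBall (0 : ℂ) r).exists_bound_of_continuousOn
    (f := fun z => Complex.log (sincInv z))
    ((differentiableOn_sincInv.continuousOn.mono hsub').clog fun z hz =>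
      hslit z (mem_closedBall_zero_iff.1 hz))
  have hD0 : 0 ≤ D := (norm_nonneg _).trans (hD 0 (by simp [h0.le]))
  refine ⟨Real.exp (D * (2 * R)), (Real.exp_pos _).le, fun s hs k => ?_⟩
  have hdc : DiffContOnCl ℂ (fun z => sincInv z ^ (2 * s)) (Metric.ball 0 r) := by
    refine ((differentiableOn_sincInv_cpow s).mono ?_).diffContOnCl
    rw [closure_ball _ h0.ne']
    exact hsub'
  have hb := Complex.norm_iteratedDeriv_le_of_forall_mem_sphere_norm_le (2 * k) h0 hdc
    (C := Real.exp (D * (2 * R))) fun z hz => by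
      have hz' : ‖z‖ ≤ r := (mem_sphere_zero_iff_norm.1 hz).le
      rw [Complex.cpow_def_of_ne_zero (Complex.slitPlane_ne_zero (hslit z hz'))]
      refine (Complex.norm_exp_le_exp_norm _).trans (Real.exp_le_exp.2 ?_)
      rw [norm_mul, norm_mul]
      have h1 := hD z (mem_closedBall_zero_iff.2 hz')
      have h2 : ‖(2 : ℂ)‖ * ‖s‖ ≤ 2 * R := by rw [Complex.norm_ofNat]; gcongr
      exact mul_le_mul h1 h2 (by positivity) hD0
  rw [taylorCoeff_eq, norm_div, Complex.norm_natCast, div_le_iff₀ (by positivity)]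
  refine hb.trans_eq ?_
  ring

lemma summable_geom_ratio {r ρ : ℝ} (h0 : 0 ≤ ρ) (h : ρ < r) (C : ℝ) :
    Summable fun k : ℕ => C / r ^ (2 * k) * ρ ^ (2 * k) := by
  have hr : 0 < r := h0.trans_lt h
  have h1 : (ρ / r) ^ 2 < 1 := by
    have : ρ / r < 1 := (div_lt_one hr).2 h
    have h2 : 0 ≤ ρ / r := by positivity
    nlinarith
  refine ((summable_geometric_of_lt_one (by positivity) h1).mul_left C).congr fun k => ?_
  rw [← pow_mul, div_pow]
  ring

lemma summable_norm_taylorCoeff (s : ℂ) {ρ : ℝ} (h0 : 0 ≤ ρ) (h : ρ < 2 * Real.pi) :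
    Summable fun k : ℕ => ‖taylorCoeff k s‖ * ρ ^ (2 * k) := by
  obtain ⟨r, h1, h2⟩ := exists_between h
  obtain ⟨C, hC0, hC⟩ := exists_norm_taylorCoeff_le ‖s‖ (h0.trans_lt h1) h2
  refine Summable.of_nonneg_of_le (fun k => by positivity) (fun k => ?_)
    (summable_geom_ratio h0 h1 C)
  gcongr
  exact hC s le_rfl k

/-- The quotient of the Taylor remainder of `((z / 2) / sin (z / 2)) ^ (2 s)` by `z ^ (2 M)`. -/
def taylorRemainder (M : ℕ) (s z : ℂ) : ℂ := ∑' k : ℕ, taylorCoeff (k + M) s * z ^ (2 * k)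

lemma differentiableOn_taylorRemainder (M : ℕ) (s : ℂ) :
    DifferentiableOn ℂ (taylorRemainder M s) (Metric.ball 0 (2 * Real.pi)) := by
  intro z hz
  obtain ⟨ρ, h1, h2⟩ := exists_between (mem_ball_zero_iff.1 hz)
  have hρ : 0 < ρ := (norm_nonneg z).trans_lt h1
  have hsum : Summable fun k : ℕ => ‖taylorCoeff (k + M) s‖ * ρ ^ (2 * k) := by
    have := ((summable_nat_add_iff M).2 (summable_norm_taylorCoeff s hρ.le h2)).mul_right
      ((ρ ^ (2 * M))⁻¹)
    refine this.congr fun k => ?_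
    rw [mul_add, pow_add]
    field_simp
  have := Complex.differentiableOn_tsum_of_summable_norm (U := Metric.ball (0 : ℂ) ρ)
    (F := fun k z => taylorCoeff (k + M) s * z ^ (2 * k)) hsum
    (fun j => by fun_prop) Metric.isOpen_ball (fun j z hz => by
      rw [norm_mul, norm_pow]
      gcongr
      exact (mem_ball_zero_iff.1 hz).le)
  exact (this.differentiableAt
    (Metric.isOpen_ball.mem_nhds (by simpa using h1))).differentiableWithinAt

lemma taylorRemainder_neg (M : ℕ) (s z : ℂ) :
    taylorRemainder M s (-z) = taylorRemainder M s z := by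
  simp [taylorRemainder, pow_mul]

lemma hasSum_taylorRemainder (M : ℕ) (s : ℂ) {z : ℂ} (hz : ‖z‖ < 2 * Real.pi) :
    HasSum (fun k : ℕ => taylorCoeff (k + M) s * z ^ (2 * (k + M)))
      (z ^ (2 * M) * taylorRemainder M s z) := by
  have hs : Summable fun k : ℕ => taylorCoeff (k + M) s * z ^ (2 * (k + M)) :=
    (summable_nat_add_iff M).2 (hasSum_taylorCoeff s hz).summable
  convert! hs.hasSum using 1
  rw [taylorRemainder, ← tsum_mul_left]
  refine tsum_congr fun k => ?_
  ring

lemma sincInv_cpow_eq (M : ℕ) (s : ℂ) {z : ℂ} (hz : ‖z‖ < 2 * Real.pi) :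
    sincInv z ^ (2 * s) = ∑ k ∈ Finset.range M, taylorCoeff k s * z ^ (2 * k) +
      z ^ (2 * M) * taylorRemainder M s z := by
  have h := hasSum_taylorCoeff s hz
  rw [← h.tsum_eq, ← h.summable.sum_add_tsum_nat_add M, (hasSum_taylorRemainder M s hz).tsum_eq]

/-! ### The spectral zeta function of the lattice -/

/-- The terms of the series for the spectral zeta function of `ℤ`, obtained by integrating
the Taylor series of `((z / 2) / sin (z / 2)) ^ (2 s)` term by term. -/
def latticeZetaTerm (s : ℂ) (k : ℕ) : ℂ :=
  taylorCoeff k s * (Real.pi : ℂ) ^ (2 * k) * (Real.pi : ℂ) ^ (-2 * s) / (2 * k + 1 - 2 * s)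

/-- The spectral zeta function of `ℤ`. -/
def latticeZeta (s : ℂ) : ℂ := ∑' k : ℕ, latticeZetaTerm s k

/-- After the first `R` terms the denominators have real part at least `1`, so the tail has no poles
in the disc and converges uniformly there. -/
lemma exists_bound_latticeZetaTerm (R : ℕ) : ∃ u : ℕ → ℝ, Summable u ∧ ∀ s : ℂ, ‖s‖ ≤ R →
    ∀ k : ℕ, ‖latticeZetaTerm s (k + R)‖ ≤ u k := by
  have hpi := Real.pi_pos
  -- Any radius strictly between `π`, where the series is evaluated, and `2π` would do.
  obtain ⟨C, hC0, hC⟩ := exists_norm_taylorCoeff_le (R : ℝ) (r := 3 / 2 * Real.pi)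
    (by positivity) (by linarith)
  refine ⟨fun k => C / (3 / 2 * Real.pi) ^ (2 * (k + R)) * Real.pi ^ (2 * (k + R)) *
    Real.pi ^ (2 * (R : ℝ)), ?_, fun s hs k => ?_⟩
  · exact ((summable_nat_add_iff R).2
      (summable_geom_ratio hpi.le (by linarith : Real.pi < 3 / 2 * Real.pi) C)).mul_right _
  · have hre := abs_le.1 ((Complex.abs_re_le_norm s).trans hs)
    rw [latticeZetaTerm, norm_div, norm_mul, norm_mul, norm_pow, Complex.norm_real,
      Real.norm_of_nonneg hpi.le, Complex.norm_cpow_eq_rpow_re_of_pos hpi]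
    have hden : 1 ≤ ‖(2 * (k + R : ℕ) + 1 - 2 * s : ℂ)‖ := by
      refine le_trans ?_ (Complex.re_le_norm _)
      simp
      linarith [(Nat.cast_nonneg k : (0 : ℝ) ≤ k)]
    refine (div_le_self (by positivity) hden).trans ?_
    beta_reduce
    gcongr
    · exact hC s hs _
    · linarith [Real.pi_gt_three]
    · simp
      linarith

lemma summable_latticeZetaTerm (s : ℂ) : Summable (latticeZetaTerm s) := by
  obtain ⟨R, hR⟩ := exists_nat_ge ‖s‖
  obtain ⟨u, hu, hb⟩ := exists_bound_latticeZetaTerm R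
  exact (summable_nat_add_iff R).1 (Summable.of_norm_bounded hu (hb s hR))

lemma differentiableAt_latticeZetaTerm {s : ℂ} {k : ℕ} (hs : s ≠ (k : ℂ) + 1 / 2) :
    DifferentiableAt ℂ (fun s => latticeZetaTerm s k) s := by
  have hpi : (Real.pi : ℂ) ≠ 0 := by exact_mod_cast Real.pi_pos.ne'
  have hden : (2 * k + 1 - 2 * s : ℂ) ≠ 0 := fun h => hs (by linear_combination -h / 2)
  have h1 := differentiable_taylorCoeff k s
  have h2 : DifferentiableAt ℂ (fun s : ℂ => (Real.pi : ℂ) ^ (-2 * s)) s :=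
    (differentiableAt_id.const_mul (-2 : ℂ)).const_cpow (Or.inl hpi)
  exact ((h1.mul_const _).mul h2).div (by fun_prop) hden

lemma differentiableOn_latticeZeta :
    DifferentiableOn ℂ latticeZeta {s : ℂ | ∀ k : ℕ, s ≠ (k : ℂ) + 1 / 2} := by
  intro s hs
  obtain ⟨R, hR⟩ := exists_nat_gt ‖s‖
  obtain ⟨u, hu, hb⟩ := exists_bound_latticeZetaTerm R
  have heq : latticeZeta = fun s => ∑ k ∈ Finset.range R, latticeZetaTerm s k +
      ∑' k, latticeZetaTerm s (k + R) := by
    ext s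
    rw [latticeZeta, (summable_latticeZetaTerm s).sum_add_tsum_nat_add R]
  rw [heq]
  refine DifferentiableAt.differentiableWithinAt (DifferentiableAt.add ?_ ?_)
  · exact DifferentiableAt.fun_sum fun k _ => differentiableAt_latticeZetaTerm (hs k)
  · refine (Complex.differentiableOn_tsum_of_summable_norm (U := Metric.ball (0 : ℂ) R)
      (F := fun k s => latticeZetaTerm s (k + R)) hu (fun k w hw => ?_) Metric.isOpen_ball
      (fun k w hw => hb w (mem_ball_zero_iff.1 hw).le k)).differentiableAt
      (Metric.isOpen_ball.mem_nhds (by simpa using hR))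
    refine (differentiableAt_latticeZetaTerm fun h => ?_).differentiableWithinAt
    have h1 := (Complex.re_le_norm w).trans_lt (mem_ball_zero_iff.1 hw)
    rw [h] at h1
    simp at h1
    linarith [(Nat.cast_nonneg k : (0 : ℝ) ≤ k)]

/-! ### The symbol `(4 sin² (π x)) ^ (-s)` -/

/-- The function `(4 sin² (π x)) ^ (-s)`. -/
def symbol (s : ℂ) (x : ℝ) : ℂ := ((4 * Real.sin (Real.pi * x) ^ 2 : ℝ) : ℂ) ^ (-s)

lemma discreteZeta_eq (n : ℕ) (s : ℂ) (θ : ℝ) :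
    discreteZeta n s θ = ∑ j ∈ Finset.range n, symbol s (((j : ℝ) + θ) / n) := by
  simp only [discreteZeta, symbol, mul_div_assoc]

lemma symbol_one_sub (s : ℂ) (x : ℝ) : symbol s (1 - x) = symbol s x := by
  rw [symbol, symbol, mul_sub, mul_one, Real.sin_pi_sub]

lemma sin_pi_mul_pos {x : ℝ} (h0 : 0 < x) (h1 : x < 1) : 0 < Real.sin (Real.pi * x) :=
  Real.sin_pos_of_pos_of_lt_pi (by positivity) (by nlinarith [Real.pi_pos])

lemma symbol_eq_mul {x : ℝ} (h0 : 0 < x) (h1 : x < 1) (s : ℂ) :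
    symbol s x = ((2 * Real.pi * x : ℝ) : ℂ) ^ (-2 * s) *
      sincInv ((2 * Real.pi * x : ℝ) : ℂ) ^ (2 * s) := by
  have hsin := sin_pi_mul_pos h0 h1
  set a : ℝ := 2 * Real.sin (Real.pi * x) with ha
  set b : ℝ := 2 * Real.pi * x with hb
  have ha0 : 0 < a := by positivity
  have hb0 : 0 < b := by have := Real.pi_pos; positivity
  have hac : (a : ℂ) ≠ 0 := by exact_mod_cast ha0.ne'
  have hbc : (b : ℂ) ≠ 0 := by exact_mod_cast hb0.ne'
  have e1 : symbol s x = (a : ℂ) ^ (-2 * s) := by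
    rw [symbol, show 4 * Real.sin (Real.pi * x) ^ 2 = a * a by rw [ha]; ring, Complex.ofReal_mul,
      Complex.mul_cpow_ofReal_nonneg ha0.le ha0.le, ← Complex.cpow_add _ _ hac]
    ring_nf
  have e2 : sincInv (b : ℂ) = ((b / a : ℝ) : ℂ) := by
    rw [sincInv, if_neg hbc, hb, ha]
    push_cast
    rw [show (2 * Real.pi * x / 2 : ℂ) = Real.pi * x by ring]
    field_simp
  have hba : 0 ≤ b / a := by positivity
  have e3 : (b : ℂ) ^ (2 * s) = ((b / a : ℝ) : ℂ) ^ (2 * s) * (a : ℂ) ^ (2 * s) := by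
    rw [← Complex.mul_cpow_ofReal_nonneg hba ha0.le, ← Complex.ofReal_mul,
      div_mul_cancel₀ _ ha0.ne']
  have hn1 : (a : ℂ) ^ (2 * s) ≠ 0 := fun h => hac ((Complex.cpow_eq_zero_iff _ _).1 h).1
  have hn2 : (b : ℂ) ^ (2 * s) ≠ 0 := fun h => hbc ((Complex.cpow_eq_zero_iff _ _).1 h).1
  rw [e1, e2, neg_mul, Complex.cpow_neg, Complex.cpow_neg]
  field_simp
  rw [e3]
  ring

lemma cpow_neg_two_mul_sub {z : ℂ} (hz : z ≠ 0) (s : ℂ) (k : ℕ) :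
    z ^ (-2 * (s - k)) = z ^ (-2 * s) * z ^ (2 * k) := by
  rw [← Complex.cpow_natCast, ← Complex.cpow_add _ _ hz]
  push_cast
  ring_nf

/-- The singular part of order `M` at `x = 0` of the symbol is removed in this function. -/
def symbolRemainder (M : ℕ) (s : ℂ) (y : ℝ) : ℂ :=
  ((2 * Real.pi : ℝ) : ℂ) ^ (-2 * (s - M)) * ((|y| : ℝ) : ℂ) ^ (-2 * (s - M)) *
    taylorRemainder M s ((2 * Real.pi : ℝ) * y : ℂ)

lemma symbolRemainder_neg (M : ℕ) (s : ℂ) (y : ℝ) :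
    symbolRemainder M s (-y) = symbolRemainder M s y := by
  simp only [symbolRemainder, abs_neg, Complex.ofReal_neg, mul_neg, taylorRemainder_neg]

lemma two_pi_ne_zero : ((2 * Real.pi : ℝ) : ℂ) ≠ 0 := by exact_mod_cast Real.two_pi_pos.ne'

lemma norm_two_pi_mul_lt {x : ℝ} (h : |x| < 1) :
    ‖(((2 * Real.pi : ℝ) : ℂ) * x)‖ < 2 * Real.pi := by
  rw [← Complex.ofReal_mul, Complex.norm_real, Real.norm_eq_abs, abs_mul,
    abs_of_pos Real.two_pi_pos]
  exact mul_lt_of_lt_one_right Real.two_pi_pos h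

lemma symbol_eq_sum {x : ℝ} (h0 : 0 < x) (h1 : x < 1) (M : ℕ) (s : ℂ) :
    symbol s x = ∑ k ∈ Finset.range M, taylorCoeff k s *
      (((2 * Real.pi : ℝ) : ℂ) ^ (-2 * (s - k)) * (x : ℂ) ^ (-2 * (s - k))) +
      symbolRemainder M s x := by
  have hx : (x : ℂ) ≠ 0 := by exact_mod_cast h0.ne'
  have habs : |x| < 1 := abs_lt.2 ⟨by linarith, h1⟩
  rw [symbol_eq_mul h0 h1, Complex.ofReal_mul, sincInv_cpow_eq M s (norm_two_pi_mul_lt habs),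
    Complex.mul_cpow_ofReal_nonneg Real.two_pi_pos.le h0.le, symbolRemainder, abs_of_pos h0,
    cpow_neg_two_mul_sub two_pi_ne_zero, cpow_neg_two_mul_sub hx, mul_add, Finset.mul_sum]
  congr 1
  · refine Finset.sum_congr rfl fun k _ => ?_
    rw [cpow_neg_two_mul_sub two_pi_ne_zero, cpow_neg_two_mul_sub hx, mul_pow]
    ring
  · rw [mul_pow]
    ring

lemma contDiffOn_symbolRemainder {L M : ℕ} {s : ℂ} (h : L + s.re < M) :
    ContDiffOn ℝ L (symbolRemainder M s) (Set.Ioo (-1) 1) := by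
  have h1 : ContDiff ℝ L fun y : ℝ => ((|y| : ℝ) : ℂ) ^ (-2 * (s - M)) :=
    contDiff_abs_cpow L _ (by simp; linarith)
  have h2 : ContDiffOn ℝ L (fun y : ℝ => taylorRemainder M s ((2 * Real.pi : ℝ) * y : ℂ))
      (Set.Ioo (-1) 1) := by
    refine contDiffOn_comp_ofReal (f := fun z => taylorRemainder M s ((2 * Real.pi : ℝ) * z)) ?_
    refine (differentiableOn_taylorRemainder M s).comp (by fun_prop) fun z hz => ?_
    have hz' := mem_ball_zero_iff.1 hz
    rw [mem_ball_zero_iff, norm_mul, Complex.norm_real, Real.norm_of_nonneg Real.two_pi_pos.le]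
    exact mul_lt_of_lt_one_right Real.two_pi_pos hz'
  exact (contDiffOn_const.mul h1.contDiffOn).mul h2

lemma contDiffOn_hurwitzTail (L : ℕ) (w : ℂ) :
    ContDiffOn ℝ L (fun y : ℝ => hurwitzTail w y) (Set.Ioo (-1) 1) :=
  contDiffOn_comp_ofReal (differentiableOn_hurwitzTail w)

lemma contDiffOn_hurwitzTail_neg (L : ℕ) (w : ℂ) :
    ContDiffOn ℝ L (fun y : ℝ => hurwitzTail w (-y)) (Set.Ioo (-1) 1) := by
  have := (contDiffOn_hurwitzTail L w).comp (g := fun y : ℝ => hurwitzTail w y)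
    (f := fun y : ℝ => -y) (s := Set.Ioo (-1) 1) contDiff_neg.contDiffOn
    (fun y hy => ⟨by linarith [hy.2], by linarith [hy.1]⟩)
  refine this.congr fun y _ => ?_
  simp

/-! ### The regular parts -/

/-- The difference of the symbol and a finite sum of circle zeta functions, as an even function
near `0`. -/
def evenPart (M : ℕ) (s : ℂ) (y : ℝ) : ℂ :=
  symbolRemainder M s y - ∑ k ∈ Finset.range M, taylorCoeff k s *
    (((2 * Real.pi : ℝ) : ℂ) ^ (-2 * (s - k)) * (2 * riemannZeta (2 * (s - k)) +
      hurwitzTail (2 * (s - k)) y + hurwitzTail (2 * (s - k)) (-y)))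

lemma evenPart_eq {x : ℝ} (h0 : 0 < x) (h1 : x < 1) (M : ℕ) (s : ℂ) :
    evenPart M s x = symbol s x -
      ∑ k ∈ Finset.range M, taylorCoeff k s * circleZeta (s - k) x := by
  rw [symbol_eq_sum h0 h1 M, evenPart, add_comm, add_sub_assoc, sub_eq_add_neg,
    ← Finset.sum_sub_distrib, ← Finset.sum_neg_distrib]
  congr 1
  refine Finset.sum_congr rfl fun k _ => ?_
  rw [circleZeta_eq h0 h1]
  ring

lemma evenPart_neg (M : ℕ) (s : ℂ) (y : ℝ) : evenPart M s (-y) = evenPart M s y := by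
  simp only [evenPart, symbolRemainder_neg, Complex.ofReal_neg, neg_neg]
  congr 1
  refine Finset.sum_congr rfl fun k _ => ?_
  ring

lemma circleZeta_one_sub (s : ℂ) (x : ℝ) : circleZeta s (1 - x) = circleZeta s x := by
  rw [circleZeta, circleZeta, sub_sub_cancel, add_comm]

lemma circleZetaDeriv_one_sub (s : ℂ) (x : ℝ) :
    circleZetaDeriv s (1 - x) = -circleZetaDeriv s x := by
  rw [circleZetaDeriv, circleZetaDeriv, sub_sub_cancel]
  ring

/-- Combined with evenness, this gives the gluing condition `evenPart M s (x - 1) = evenPart M s x`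
of the periodic extension. -/
lemma evenPart_one_sub {x : ℝ} (h0 : 0 < x) (h1 : x < 1) (M : ℕ) (s : ℂ) :
    evenPart M s (1 - x) = evenPart M s x := by
  rw [evenPart_eq h0 h1, evenPart_eq (by linarith) (by linarith), symbol_one_sub]
  simp only [circleZeta_one_sub]

lemma contDiffOn_evenPart {L M : ℕ} {s : ℂ} (h : L + s.re < M) :
    ContDiffOn ℝ L (evenPart M s) (Set.Ioo (-1) 1) := by
  refine (contDiffOn_symbolRemainder h).sub (ContDiffOn.sum fun k _ => ?_)
  exact contDiffOn_const.mul (contDiffOn_const.mul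
    ((contDiffOn_const.add (contDiffOn_hurwitzTail L _)).add (contDiffOn_hurwitzTail_neg L _)))

/-- The difference of the derivative of the symbol and a finite sum of derivatives of circle zeta
functions, as an odd function near `0`. -/
def oddPart (M : ℕ) (s : ℂ) (y : ℝ) : ℂ :=
  deriv (symbolRemainder M s) y - ∑ k ∈ Finset.range M, taylorCoeff k s *
    (-2 * (s - k) * ((2 * Real.pi : ℝ) : ℂ) ^ (-2 * (s - k)) *
      (hurwitzTail (1 + 2 * (s - k)) y - hurwitzTail (1 + 2 * (s - k)) (-y)))

lemma hasDerivAt_symbolRemainder {M : ℕ} {s : ℂ} (h : 1 + s.re < M) {y : ℝ}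
    (hy : y ∈ Set.Ioo (-1 : ℝ) 1) :
    HasDerivAt (symbolRemainder M s) (deriv (symbolRemainder M s) y) y := by
  have := (contDiffOn_symbolRemainder (L := 1) (by simpa using h)).contDiffAt
    (isOpen_Ioo.mem_nhds hy)
  exact (this.differentiableAt (by simp)).hasDerivAt

lemma hasDerivAt_symbol {x : ℝ} (h0 : 0 < x) (h1 : x < 1) {M : ℕ} {s : ℂ} (h : 1 + s.re < M) :
    HasDerivAt (symbol s) (∑ k ∈ Finset.range M, taylorCoeff k s *
      (((2 * Real.pi : ℝ) : ℂ) ^ (-2 * (s - k)) * (-2 * (s - k) * (x : ℂ) ^ (-2 * (s - k) - 1))) +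
      deriv (symbolRemainder M s) x) x := by
  have hr := hasDerivAt_symbolRemainder h (y := x) ⟨by linarith, h1⟩
  have hs : HasDerivAt (fun x : ℝ => ∑ k ∈ Finset.range M, taylorCoeff k s *
      (((2 * Real.pi : ℝ) : ℂ) ^ (-2 * (s - k)) * (x : ℂ) ^ (-2 * (s - k))))
      (∑ k ∈ Finset.range M, taylorCoeff k s * (((2 * Real.pi : ℝ) : ℂ) ^ (-2 * (s - k)) *
        (-2 * (s - k) * (x : ℂ) ^ (-2 * (s - k) - 1)))) x :=
    HasDerivAt.fun_sum fun k _ =>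
      ((hasDerivAt_ofReal_cpow_of_pos h0 (-2 * (s - k))).const_mul _).const_mul _
  refine (hs.add hr).congr_of_eventuallyEq ?_
  filter_upwards [isOpen_Ioo.mem_nhds (show x ∈ Set.Ioo 0 1 from ⟨h0, h1⟩)] with t ht
    using symbol_eq_sum ht.1 ht.2 M s

lemma differentiableAt_symbol {x : ℝ} (h0 : 0 < x) (h1 : x < 1) (s : ℂ) :
    DifferentiableAt ℝ (symbol s) x := by
  obtain ⟨M, hM⟩ := exists_nat_gt (1 + s.re)
  exact (hasDerivAt_symbol h0 h1 hM).differentiableAt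

lemma oddPart_eq {x : ℝ} (h0 : 0 < x) (h1 : x < 1) {M : ℕ} {s : ℂ} (h : 1 + s.re < M) :
    oddPart M s x = deriv (symbol s) x -
      ∑ k ∈ Finset.range M, taylorCoeff k s * circleZetaDeriv (s - k) x := by
  rw [(hasDerivAt_symbol h0 h1 h).deriv, oddPart, add_comm, add_sub_assoc, sub_eq_add_neg,
    ← Finset.sum_sub_distrib, ← Finset.sum_neg_distrib]
  congr 1
  refine Finset.sum_congr rfl fun k _ => ?_
  rw [circleZetaDeriv_eq h0 h1]
  ring

lemma oddPart_neg (M : ℕ) (s : ℂ) (y : ℝ) : oddPart M s (-y) = -oddPart M s y := by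
  have hd : deriv (symbolRemainder M s) (-y) = -deriv (symbolRemainder M s) y := by
    have := deriv_comp_neg (f := symbolRemainder M s) y
    simp only [symbolRemainder_neg] at this
    rw [this, neg_neg]
  simp only [oddPart, hd, Complex.ofReal_neg, neg_neg]
  rw [neg_sub, sub_eq_add_neg, ← Finset.sum_neg_distrib, neg_add_eq_sub]
  congr 1
  refine Finset.sum_congr rfl fun k _ => ?_
  ring

lemma oddPart_one_sub {x : ℝ} (h0 : 0 < x) (h1 : x < 1) {M : ℕ} {s : ℂ} (h : 1 + s.re < M) :
    oddPart M s (1 - x) = -oddPart M s x := by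
  have hd : deriv (symbol s) (1 - x) = -deriv (symbol s) x := by
    have := deriv_comp_const_sub (f := symbol s) 1 x
    simp only [symbol_one_sub] at this
    rw [this, neg_neg]
  rw [oddPart_eq h0 h1 h, oddPart_eq (by linarith) (by linarith) h, hd, neg_sub, sub_eq_add_neg,
    ← Finset.sum_neg_distrib, neg_add_eq_sub]
  congr 1
  refine Finset.sum_congr rfl fun k _ => ?_
  rw [circleZetaDeriv_one_sub]
  ring

lemma contDiffOn_oddPart {L M : ℕ} {s : ℂ} (h : L + 1 + s.re < M) :
    ContDiffOn ℝ L (oddPart M s) (Set.Ioo (-1) 1) := by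
  have h1 : ContDiffOn ℝ ((L : WithTop ℕ∞) + 1) (symbolRemainder M s) (Set.Ioo (-1) 1) := by
    exact_mod_cast contDiffOn_symbolRemainder (L := L + 1) (by push_cast; exact h)
  refine ((contDiffOn_succ_iff_deriv_of_isOpen isOpen_Ioo).1 h1).2.2.sub
    (ContDiffOn.sum fun k _ => ?_)
  exact contDiffOn_const.mul (contDiffOn_const.mul
    ((contDiffOn_hurwitzTail L _).sub (contDiffOn_hurwitzTail_neg L _)))

/-! ### Integrals of the regular parts -/

lemma two_pi_cpow_mul_half_cpow (s : ℂ) (k : ℕ) :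
    ((2 * Real.pi : ℝ) : ℂ) ^ (-2 * (s - k)) *
      (((1 / 2 : ℝ) : ℂ) ^ (-2 * (s - k) + 1) / (-2 * (s - k) + 1)) * taylorCoeff k s =
      latticeZetaTerm s k / 2 := by
  have hpi : (Real.pi : ℂ) ≠ 0 := by exact_mod_cast Real.pi_pos.ne'
  have hh : ((1 / 2 : ℝ) : ℂ) ≠ 0 := by norm_num
  have h := Complex.mul_cpow_ofReal_nonneg Real.two_pi_pos.le (by norm_num : (0 : ℝ) ≤ 1 / 2)
    (-2 * (s - k))
  have h2 : (((2 * Real.pi : ℝ) : ℂ) * ((1 / 2 : ℝ) : ℂ)) = (Real.pi : ℂ) := by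
    push_cast
    ring
  rw [h2, cpow_neg_two_mul_sub hpi] at h
  rw [latticeZetaTerm, Complex.cpow_add _ _ hh, Complex.cpow_one,
    show (-2 * (s - k) + 1 : ℂ) = 2 * k + 1 - 2 * s by ring]
  calc _ = ((2 * Real.pi : ℝ) : ℂ) ^ (-2 * (s - k)) * ((1 / 2 : ℝ) : ℂ) ^ (-2 * (s - k)) *
        (((1 / 2 : ℝ) : ℂ) * taylorCoeff k s / (2 * k + 1 - 2 * s)) := by ring
    _ = _ := by
      rw [← h]
      push_cast
      ring

/-- The right side is minus the finite-part integral of the singular term `x^(-w)`: the finite-part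
integral of `ζ(w, x) + ζ(w, 1 - x)` over `[0, 1/2]` is zero. -/
lemma integral_hurwitzTail {w : ℂ} (hw : w ≠ 1) :
    ∫ x in (0 : ℝ)..(1 / 2), (2 * riemannZeta w + hurwitzTail w x + hurwitzTail w (-x)) =
      -(((1 / 2 : ℝ) : ℂ) ^ (-w + 1) / (-w + 1)) := by
  have hw' : 1 - w ≠ 0 := sub_ne_zero.2 hw.symm
  have hmem : ∀ x ∈ Set.uIcc (0 : ℝ) (1 / 2), x ∈ Set.Ioo (-1 : ℝ) 1 := fun x hx => by
    rw [Set.uIcc_of_le (by norm_num)] at hx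
    exact ⟨by linarith [hx.1], by linarith [hx.2]⟩
  have hd : ∀ x ∈ Set.uIcc (0 : ℝ) (1 / 2), HasDerivAt
      (fun x : ℝ => hurwitzTail (w - 1) x - hurwitzTail (w - 1) (-x))
      ((1 - w) * (2 * riemannZeta w + hurwitzTail w x + hurwitzTail w (-x))) x := fun x hx =>
    (hasDerivAt_hurwitzTail_sub hw (x := (x : ℂ)) (by simpa using abs_lt.2 (hmem x hx))).comp_ofReal
  have hc : ContinuousOn (fun x : ℝ => 2 * riemannZeta w + hurwitzTail w x + hurwitzTail w (-x))
      (Set.uIcc (0 : ℝ) (1 / 2)) :=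
    ((continuousOn_const.add (contDiffOn_hurwitzTail 0 w).continuousOn).add
      (contDiffOn_hurwitzTail_neg 0 w).continuousOn).mono hmem
  have hi := intervalIntegral.integral_eq_sub_of_hasDerivAt hd
    (hc.const_mul (1 - w)).intervalIntegrable
  rw [intervalIntegral.integral_const_mul] at hi
  -- The point `1/2` is fixed by `x ↦ 1 - x`, so comparing the two local forms of the same Hurwitz
  -- value gives the primitive at `1/2`.
  have e1 := hurwitzZeta_eq (x := 1 / 2) (by norm_num) (by norm_num) (w - 1)
  have e2 := hurwitzZeta_one_sub_eq (x := 1 / 2) (by norm_num) (by norm_num) (w - 1)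
  rw [show (1 - 1 / 2 : ℝ) = 1 / 2 by norm_num] at e2
  rw [e2] at e1
  rw [show -w + 1 = 1 - w by ring, eq_neg_iff_add_eq_zero]
  rw [show -(w - 1) = 1 - w by ring] at e1
  simp only [Complex.ofReal_zero, neg_zero, sub_self, sub_zero] at hi
  field_simp
  linear_combination hi - e1

/-- Termwise integration of the tail of the expansion. The hypothesis puts every exponent above
`-1`, and `2πx ≤ π` stays inside the disc of convergence. -/
lemma integral_symbolRemainder {M : ℕ} {s : ℂ} (h : s.re < M + 1 / 2) :
    HasSum (fun k : ℕ => latticeZetaTerm s (k + M) / 2)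
      (∫ x in Set.Ioc (0 : ℝ) (1 / 2), symbolRemainder M s x) := by
  set F : ℕ → ℝ → ℂ := fun k x => taylorCoeff (k + M) s *
    (((2 * Real.pi : ℝ) : ℂ) ^ (-2 * (s - (k + M : ℕ))) * (x : ℂ) ^ (-2 * (s - (k + M : ℕ))))
    with hF
  have hre : ∀ k : ℕ, -1 < (-2 * (s - (k + M : ℕ))).re := fun k => by
    simp
    linarith [(Nat.cast_nonneg k : (0 : ℝ) ≤ k)]
  have hint : ∀ k, MeasureTheory.Integrable (F k)
      (MeasureTheory.volume.restrict (Set.Ioc (0 : ℝ) (1 / 2))) := fun k => by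
    have := intervalIntegral.intervalIntegrable_cpow' (hre k) (a := 0) (b := 1 / 2)
    rw [intervalIntegrable_iff_integrableOn_Ioc_of_le (by norm_num)] at this
    exact (this.const_mul _).const_mul _
  have hval : ∀ k, ∫ x in Set.Ioc (0 : ℝ) (1 / 2), F k x = latticeZetaTerm s (k + M) / 2 :=
    fun k => by
      have hne : -2 * (s - (k + M : ℕ)) + 1 ≠ 0 := fun h0 => by
        have h1 := congrArg Complex.re h0
        have h2 := hre k
        rw [Complex.add_re, Complex.one_re, Complex.zero_re] at h1
        linarith
      simp only [hF]
      rw [MeasureTheory.integral_const_mul, MeasureTheory.integral_const_mul,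
        ← intervalIntegral.integral_of_le (by norm_num), integral_cpow (Or.inl (hre k)),
        Complex.ofReal_zero, Complex.zero_cpow hne, sub_zero, mul_comm,
        two_pi_cpow_mul_half_cpow]
  have hnorm : ∀ k, ∫ x in Set.Ioc (0 : ℝ) (1 / 2), ‖F k x‖ =
      ‖taylorCoeff (k + M) s‖ * ((2 * Real.pi) ^ (-2 * (s - (k + M : ℕ))).re *
        ((1 / 2) ^ ((-2 * (s - (k + M : ℕ))).re + 1) / ((-2 * (s - (k + M : ℕ))).re + 1))) :=
    fun k => by
      have hr := hre k
      have : ∀ x ∈ Set.Ioc (0 : ℝ) (1 / 2), ‖F k x‖ = ‖taylorCoeff (k + M) s‖ *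
          ((2 * Real.pi) ^ (-2 * (s - (k + M : ℕ))).re * x ^ (-2 * (s - (k + M : ℕ))).re) := by
        intro x hx
        simp only [hF]
        rw [norm_mul, norm_mul, Complex.norm_cpow_eq_rpow_re_of_pos Real.two_pi_pos,
          Complex.norm_cpow_eq_rpow_re_of_pos hx.1]
      rw [MeasureTheory.setIntegral_congr_fun measurableSet_Ioc this,
        MeasureTheory.integral_const_mul, MeasureTheory.integral_const_mul,
        ← intervalIntegral.integral_of_le (by norm_num), integral_rpow (Or.inl hr),
        Real.zero_rpow (by linarith), sub_zero]
  have hsum : Summable fun k => ∫ x in Set.Ioc (0 : ℝ) (1 / 2), ‖F k x‖ := by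
    have hδ : 0 < 2 * M - 2 * s.re + 1 := by linarith
    have hb := ((summable_nat_add_iff M).2 (summable_norm_taylorCoeff s Real.pi_pos.le
      (by linarith [Real.pi_pos]))).mul_right
      (Real.pi ^ (-2 * s.re) * (1 / 2) / (2 * M - 2 * s.re + 1))
    refine Summable.of_nonneg_of_le (fun k => MeasureTheory.integral_nonneg fun _ => norm_nonneg _)
      (fun k => ?_) hb
    rw [hnorm k]
    have hr : (-2 * (s - (k + M : ℕ))).re = -2 * s.re + ((2 * (k + M) : ℕ) : ℝ) := by
      simp
      ring
    rw [hr, Real.rpow_add (by norm_num) _ 1, Real.rpow_one]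
    have e : (2 * Real.pi) ^ (-2 * s.re + ((2 * (k + M) : ℕ) : ℝ)) *
        (1 / 2) ^ (-2 * s.re + ((2 * (k + M) : ℕ) : ℝ)) =
        Real.pi ^ (-2 * s.re) * Real.pi ^ (2 * (k + M)) := by
      rw [← Real.mul_rpow Real.two_pi_pos.le (by norm_num), ← Real.rpow_natCast Real.pi,
        ← Real.rpow_add Real.pi_pos]
      congr 1
      ring
    calc _ = ‖taylorCoeff (k + M) s‖ * ((2 * Real.pi) ^ (-2 * s.re + ((2 * (k + M) : ℕ) : ℝ)) *
          (1 / 2) ^ (-2 * s.re + ((2 * (k + M) : ℕ) : ℝ))) * (1 / 2) /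
          (-2 * s.re + ((2 * (k + M) : ℕ) : ℝ) + 1) := by ring
      _ ≤ ‖taylorCoeff (k + M) s‖ * ((2 * Real.pi) ^ (-2 * s.re + ((2 * (k + M) : ℕ) : ℝ)) *
          (1 / 2) ^ (-2 * s.re + ((2 * (k + M) : ℕ) : ℝ))) * (1 / 2) /
          (2 * M - 2 * s.re + 1) := by
        have := Real.pi_pos
        refine div_le_div_of_nonneg_left (by positivity) hδ ?_
        push_cast
        linarith [(Nat.cast_nonneg k : (0 : ℝ) ≤ k)]
      _ = _ := by rw [e]; ring
  have hS := MeasureTheory.hasSum_integral_of_summable_integral_norm hint hsum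
  simp only [hval] at hS
  convert! hS using 1
  refine MeasureTheory.setIntegral_congr_fun measurableSet_Ioc fun x hx => ?_
  have hx0 : (x : ℂ) ≠ 0 := by exact_mod_cast hx.1.ne'
  have habs : |x| < 1 := abs_lt.2 ⟨by linarith [hx.1], by linarith [hx.2]⟩
  have hT := (hasSum_taylorRemainder M s (norm_two_pi_mul_lt habs)).mul_left
    (((2 * Real.pi : ℝ) : ℂ) ^ (-2 * s) * (x : ℂ) ^ (-2 * s))
  have : HasSum (fun k => F k x) (symbolRemainder M s x) := by
    convert! hT using 1
    · funext k
      simp only [hF]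
      rw [cpow_neg_two_mul_sub two_pi_ne_zero, cpow_neg_two_mul_sub hx0, mul_pow]
      ring
    · rw [symbolRemainder, abs_of_pos hx.1, cpow_neg_two_mul_sub two_pi_ne_zero,
        cpow_neg_two_mul_sub hx0, mul_pow]
      ring
  exact this.tsum_eq.symm

/-- The remainder contributes the terms `k ≥ M` of the series, and the regular parts of the
subtracted circle zeta functions contribute the terms `k < M`. -/
lemma integral_evenPart {M : ℕ} {s : ℂ} (hs : ∀ k : ℕ, s ≠ (k : ℂ) + 1 / 2) (h : s.re < M) :
    ∫ x in (0 : ℝ)..(1 / 2), evenPart M s x = latticeZeta s / 2 := by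
  have hmem : Set.uIcc (0 : ℝ) (1 / 2) ⊆ Set.Ioo (-1) 1 := fun x hx => by
    rw [Set.uIcc_of_le (by norm_num)] at hx
    exact ⟨by linarith [hx.1], by linarith [hx.2]⟩
  have hc : ContinuousOn (symbolRemainder M s) (Set.Ioo (-1) 1) :=
    (contDiffOn_symbolRemainder (L := 0) (by simpa using h)).continuousOn
  have hw : ∀ k : ℕ, 2 * (s - k) ≠ 1 := fun k hk => hs k (by linear_combination hk / 2)
  have ht : ∀ k : ℕ, ContinuousOn (fun x : ℝ => taylorCoeff k s *
      (((2 * Real.pi : ℝ) : ℂ) ^ (-2 * (s - k)) * (2 * riemannZeta (2 * (s - k)) +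
      hurwitzTail (2 * (s - k)) x + hurwitzTail (2 * (s - k)) (-x)))) (Set.Ioo (-1) 1) := fun k =>
    continuousOn_const.mul (continuousOn_const.mul
      ((continuousOn_const.add (contDiffOn_hurwitzTail 0 _).continuousOn).add
        (contDiffOn_hurwitzTail_neg 0 _).continuousOn))
  have hterm : ∀ k : ℕ, ∫ x in (0 : ℝ)..(1 / 2), taylorCoeff k s *
      (((2 * Real.pi : ℝ) : ℂ) ^ (-2 * (s - k)) * (2 * riemannZeta (2 * (s - k)) +
      hurwitzTail (2 * (s - k)) x + hurwitzTail (2 * (s - k)) (-x))) =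
      -(latticeZetaTerm s k / 2) := fun k => by
    rw [intervalIntegral.integral_const_mul, intervalIntegral.integral_const_mul,
      integral_hurwitzTail (hw k), ← two_pi_cpow_mul_half_cpow, ← neg_mul]
    ring
  have hrem := integral_symbolRemainder (M := M) (s := s) (by linarith)
  rw [← intervalIntegral.integral_of_le (by norm_num)] at hrem
  unfold evenPart
  rw [intervalIntegral.integral_sub ((hc.mono hmem).intervalIntegrable)
    (ContinuousOn.intervalIntegrable (continuousOn_finsetSum _ fun k _ => (ht k).mono hmem)),
    intervalIntegral.integral_finsetSum fun k _ => ((ht k).mono hmem).intervalIntegrable,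
    ← hrem.tsum_eq]
  simp only [hterm]
  rw [latticeZeta, ← (summable_latticeZetaTerm s).sum_add_tsum_nat_add M, tsum_div_const,
    Finset.sum_neg_distrib, ← Finset.sum_div]
  ring

/-! ### Asymptotic expansions -/

lemma natCast_cpow_two_mul_sub {n : ℕ} (hn : 0 < n) (s : ℂ) (k : ℕ) :
    (n : ℂ) ^ (2 * (s - k)) = (n : ℂ) ^ (2 * s) / (n : ℂ) ^ (2 * k) := by
  have hn0 : (n : ℂ) ≠ 0 := by exact_mod_cast hn.ne'
  rw [← Complex.cpow_natCast, ← Complex.cpow_sub _ _ hn0]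
  push_cast
  ring_nf

/-- An expansion in powers `n ^ (2 s - 2 k)` with error smaller than any power of `n` when
sufficiently many terms are taken has the expected error after any number of terms. -/
lemma isBigO_of_expansion {F : ℕ → ℂ} {b : ℕ → ℂ} {s : ℂ} {m : ℕ}
    (hF : ∀ L : ℕ, ∃ M : ℕ, m + 1 ≤ M ∧ ∃ C : ℝ, ∀ n : ℕ, 0 < n →
      ‖F n - (n : ℂ) ^ (2 * s) * ∑ k ∈ Finset.range M, b k / (n : ℂ) ^ (2 * k)‖ ≤ C / (n : ℝ) ^ L) :
    (fun n : ℕ => F n - (n : ℂ) ^ (2 * s) *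
      ∑ k ∈ Finset.range (m + 1), b k / (n : ℂ) ^ (2 * k))
      =O[atTop] fun n : ℕ => (n : ℂ) ^ (2 * s) / (n : ℂ) ^ (2 + 2 * m) := by
  -- With this choice `n^(-L)` is at most the norm of `n^(2s) / n^(2 + 2m)`.
  obtain ⟨L, hL⟩ := exists_nat_ge (2 + 2 * m - 2 * s.re)
  obtain ⟨M, hM, C, hC⟩ := hF L
  have h1 : (fun n : ℕ => F n - (n : ℂ) ^ (2 * s) *
      ∑ k ∈ Finset.range M, b k / (n : ℂ) ^ (2 * k))
      =O[atTop] fun n : ℕ => (n : ℂ) ^ (2 * s) / (n : ℂ) ^ (2 + 2 * m) := by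
    refine IsBigO.of_bound |C| ?_
    filter_upwards [eventually_gt_atTop 0] with n hn
    have hnr : (0 : ℝ) < n := by exact_mod_cast hn
    have hn1 : (1 : ℝ) ≤ n := by exact_mod_cast hn
    refine (hC n hn).trans ?_
    rw [norm_div, Complex.norm_natCast_cpow_of_pos hn, norm_pow, Complex.norm_natCast,
      div_eq_mul_inv]
    have h3 : ((n : ℝ) ^ L)⁻¹ ≤ (n : ℝ) ^ (2 * s).re / (n : ℝ) ^ (2 + 2 * m) := by
      rw [← Real.rpow_natCast, ← Real.rpow_neg hnr.le, ← Real.rpow_natCast, ← Real.rpow_sub hnr]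
      refine Real.rpow_le_rpow_of_exponent_le hn1 ?_
      simp
      linarith
    calc C * ((n : ℝ) ^ L)⁻¹ ≤ |C| * ((n : ℝ) ^ L)⁻¹ := by gcongr; exact le_abs_self C
      _ ≤ _ := by gcongr
  have h2 : (fun n : ℕ => (n : ℂ) ^ (2 * s) *
      ∑ k ∈ Finset.Ico (m + 1) M, b k / (n : ℂ) ^ (2 * k))
      =O[atTop] fun n : ℕ => (n : ℂ) ^ (2 * s) / (n : ℂ) ^ (2 + 2 * m) := by
    simp only [Finset.mul_sum]
    refine IsBigO.fun_sum fun k hk => ?_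
    refine IsBigO.of_bound ‖b k‖ ?_
    filter_upwards [eventually_gt_atTop 0] with n hn
    have hn1 : (1 : ℝ) ≤ n := by exact_mod_cast hn
    have hk' := (Finset.mem_Ico.1 hk).1
    rw [norm_mul, norm_div, norm_div, norm_pow, norm_pow, Complex.norm_natCast]
    have h3 : (n : ℝ) ^ (2 + 2 * m) ≤ (n : ℝ) ^ (2 * k) := pow_le_pow_right₀ hn1 (by omega)
    calc _ = ‖b k‖ * (‖(n : ℂ) ^ (2 * s)‖ / (n : ℝ) ^ (2 * k)) := by ring
      _ ≤ _ := by gcongr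
  refine (h1.add h2).congr_left fun n => ?_
  rw [← Finset.sum_range_add_sum_Ico _ hM]
  ring

lemma integral_eq_two_mul_of_symm {g : ℝ → ℂ}
    (hg : IntervalIntegrable g MeasureTheory.volume 0 1)
    (h : ∀ x ∈ Set.Ioo (0 : ℝ) 1, g (1 - x) = g x) :
    ∫ x in (0 : ℝ)..1, g x = 2 * ∫ x in (0 : ℝ)..(1 / 2), g x := by
  have h1 : ∫ x in (1 / 2 : ℝ)..1, g x = ∫ x in (0 : ℝ)..(1 / 2), g x := by
    have := intervalIntegral.integral_comp_sub_left (a := 0) (b := 1 / 2) g 1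
    rw [sub_zero, show (1 - 1 / 2 : ℝ) = 1 / 2 by norm_num] at this
    rw [← this, intervalIntegral.integral_of_le (by norm_num),
      intervalIntegral.integral_of_le (by norm_num)]
    exact MeasureTheory.setIntegral_congr_fun measurableSet_Ioc fun x hx =>
      h x ⟨hx.1, by linarith [hx.2]⟩
  have hmem : (1 / 2 : ℝ) ∈ Set.uIcc (0 : ℝ) 1 := by
    rw [Set.uIcc_of_le zero_le_one]
    constructor <;> norm_num
  rw [← intervalIntegral.integral_add_adjacent_intervals
    (hg.mono_set (Set.uIcc_subset_uIcc Set.left_mem_uIcc hmem))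
    (hg.mono_set (Set.uIcc_subset_uIcc hmem Set.right_mem_uIcc)), h1]
  ring

lemma integral_eq_zero_of_antisymm {g : ℝ → ℂ} (h : ∀ x ∈ Set.Ioo (0 : ℝ) 1, g (1 - x) = -g x) :
    ∫ x in (0 : ℝ)..1, g x = 0 := by
  have h1 := intervalIntegral.integral_comp_sub_left (a := 0) (b := 1) g 1
  rw [sub_zero, sub_self, intervalIntegral.integral_of_le zero_le_one,
    MeasureTheory.integral_Ioc_eq_integral_Ioo,
    MeasureTheory.setIntegral_congr_fun measurableSet_Ioo h, MeasureTheory.integral_neg,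
    ← MeasureTheory.integral_Ioc_eq_integral_Ioo, ← intervalIntegral.integral_of_le zero_le_one]
    at h1
  linear_combination -h1 / 2

/-- The periodic function is taken of class `C^(L+1)`, since the Riemann sum estimate loses one
power of `n`. -/
lemma exists_discreteZeta_expansion {s : ℂ} (hs : ∀ k : ℕ, s ≠ (k : ℂ) + 1 / 2) {θ : ℝ}
    (h0 : 0 < θ) (h1 : θ < 1) (L M : ℕ) (hM : L + 1 + s.re < M) :
    ∃ C : ℝ, ∀ n : ℕ, 0 < n → ‖discreteZeta n s θ - n * latticeZeta s - (n : ℂ) ^ (2 * s) *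
      ∑ k ∈ Finset.range M, taylorCoeff k s * circleZeta (s - k) θ / (n : ℂ) ^ (2 * k)‖ ≤
        C / (n : ℝ) ^ L := by
  obtain ⟨g, hper, hg, hgeq⟩ := exists_periodic_extension
    (contDiffOn_evenPart (L := L + 1) (M := M) (s := s) (by push_cast; exact hM)) (fun x hx => by
      rw [← neg_sub, evenPart_neg, evenPart_one_sub hx.1 hx.2])
  have hint : ∫ x in (0 : ℝ)..1, g x = latticeZeta s := by
    rw [integral_eq_two_mul_of_symm (hg.continuous.intervalIntegrable 0 1) fun x hx => by
      rw [hgeq x ⟨hx.1.le, hx.2⟩, hgeq (1 - x) ⟨by linarith [hx.2], by linarith [hx.1]⟩,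
        evenPart_one_sub hx.1 hx.2]]
    have : ∫ x in (0 : ℝ)..(1 / 2), g x = ∫ x in (0 : ℝ)..(1 / 2), evenPart M s x := by
      refine intervalIntegral.integral_congr fun x hx => hgeq x ?_
      rw [Set.uIcc_of_le (by norm_num)] at hx
      exact ⟨hx.1, by linarith [hx.2]⟩
    rw [this, integral_evenPart hs (by linarith [(Nat.cast_nonneg L : (0 : ℝ) ≤ L)])]
    ring
  obtain ⟨C, hC⟩ := exists_norm_sum_sub_integral_le (L + 1) g hper hg
  refine ⟨C, fun n hn => ?_⟩
  have hnr : (n : ℝ) ≠ 0 := by exact_mod_cast hn.ne'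
  have h2 := hC n hn θ ⟨h0.le, h1.le⟩
  rw [hint] at h2
  have h3 : ∑ j ∈ Finset.range n, g ((j + θ) / n) = discreteZeta n s θ - (n : ℂ) ^ (2 * s) *
      ∑ k ∈ Finset.range M, taylorCoeff k s * circleZeta (s - k) θ / (n : ℂ) ^ (2 * k) := by
    have h4 : ∀ j ∈ Finset.range n, g ((j + θ) / n) = symbol s ((j + θ) / n) -
        ∑ k ∈ Finset.range M, taylorCoeff k s * circleZeta (s - k) ((j + θ) / n) := by
      intro j hj
      have hm := div_mem_Ioo_of_lt (Finset.mem_range.1 hj) h0 h1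
      rw [hgeq _ ⟨hm.1.le, hm.2⟩, evenPart_eq hm.1 hm.2]
    rw [Finset.sum_congr rfl h4, Finset.sum_sub_distrib, ← discreteZeta_eq, Finset.sum_comm,
      Finset.mul_sum]
    congr 1
    refine Finset.sum_congr rfl fun k _ => ?_
    rw [← Finset.mul_sum, sum_circleZeta h0 h1 hn fun h => hs k (by linear_combination h),
      natCast_cpow_two_mul_sub hn]
    ring
  rw [h3, sub_right_comm] at h2
  refine h2.trans_eq ?_
  rw [pow_succ]
  field_simp

lemma hasDerivAt_discreteZeta {θ : ℝ} (h0 : 0 < θ) (h1 : θ < 1) (n : ℕ) (s : ℂ) :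
    HasDerivAt (fun t : ℝ => discreteZeta n s t)
      (∑ j ∈ Finset.range n, (1 / n : ℝ) • deriv (symbol s) ((j + θ) / n)) θ := by
  simp only [discreteZeta_eq]
  refine HasDerivAt.fun_sum fun j hj => ?_
  have hm := div_mem_Ioo_of_lt (Finset.mem_range.1 hj) h0 h1
  refine HasDerivAt.scomp (h := fun t : ℝ => ((j : ℝ) + t) / n) θ
    (differentiableAt_symbol hm.1 hm.2 s).hasDerivAt ?_
  exact ((hasDerivAt_id θ).const_add (j : ℝ)).div_const (n : ℝ)

/-- The factor `1/n` from the chain rule makes up for the power lost in the Riemann sum estimate and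
cancels the extra `n` in `sum_circleZetaDeriv`, so class `C^L` suffices. -/
lemma exists_deriv_discreteZeta_expansion (s : ℂ) {θ : ℝ} (h0 : 0 < θ) (h1 : θ < 1) (L M : ℕ)
    (hM : L + 1 + s.re < M) :
    ∃ C : ℝ, ∀ n : ℕ, 0 < n → ‖deriv (fun t : ℝ => discreteZeta n s t) θ - (n : ℂ) ^ (2 * s) *
      ∑ k ∈ Finset.range M, taylorCoeff k s * circleZetaDeriv (s - k) θ / (n : ℂ) ^ (2 * k)‖ ≤
        C / (n : ℝ) ^ L := by
  have hM' : 1 + s.re < M := by linarith [(Nat.cast_nonneg L : (0 : ℝ) ≤ L)]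
  obtain ⟨g, hper, hg, hgeq⟩ := exists_periodic_extension
    (contDiffOn_oddPart (L := L) (M := M) (s := s) hM) (fun x hx => by
      rw [← neg_sub, oddPart_neg, oddPart_one_sub hx.1 hx.2 hM', neg_neg])
  have hint : ∫ x in (0 : ℝ)..1, g x = 0 :=
    integral_eq_zero_of_antisymm fun x hx => by
      rw [hgeq x ⟨hx.1.le, hx.2⟩, hgeq (1 - x) ⟨by linarith [hx.2], by linarith [hx.1]⟩,
        oddPart_one_sub hx.1 hx.2 hM']
  obtain ⟨C, hC⟩ := exists_norm_sum_sub_integral_le L g hper hg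
  refine ⟨C, fun n hn => ?_⟩
  have hnr : (0 : ℝ) < n := by exact_mod_cast hn
  have hnc : (n : ℂ) ≠ 0 := by exact_mod_cast hn.ne'
  have h2 := hC n hn θ ⟨h0.le, h1.le⟩
  rw [hint, mul_zero, sub_zero] at h2
  have h3 : deriv (fun t : ℝ => discreteZeta n s t) θ - (n : ℂ) ^ (2 * s) *
      ∑ k ∈ Finset.range M, taylorCoeff k s * circleZetaDeriv (s - k) θ / (n : ℂ) ^ (2 * k) =
      (1 / n : ℝ) • ∑ j ∈ Finset.range n, g ((j + θ) / n) := by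
    have h4 : ∀ j ∈ Finset.range n, g ((j + θ) / n) = deriv (symbol s) ((j + θ) / n) -
        ∑ k ∈ Finset.range M, taylorCoeff k s * circleZetaDeriv (s - k) ((j + θ) / n) := by
      intro j hj
      have hm := div_mem_Ioo_of_lt (Finset.mem_range.1 hj) h0 h1
      rw [hgeq _ ⟨hm.1.le, hm.2⟩, oddPart_eq hm.1 hm.2 hM']
    rw [(hasDerivAt_discreteZeta h0 h1 n s).deriv, Finset.sum_congr rfl h4,
      Finset.sum_sub_distrib, smul_sub, ← Finset.smul_sum, Finset.sum_comm (s := Finset.range n),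
      Finset.mul_sum, Finset.smul_sum (s := Finset.range M)]
    congr 1
    refine Finset.sum_congr rfl fun k _ => ?_
    rw [← Finset.mul_sum, sum_circleZetaDeriv h0 h1 hn, natCast_cpow_two_mul_sub hn,
      Complex.real_smul]
    push_cast
    field_simp
  rw [h3, norm_smul, Real.norm_of_nonneg (by positivity)]
  calc _ ≤ (1 / n : ℝ) * (C * n / (n : ℝ) ^ L) := by gcongr
    _ = _ := by field_simp

lemma exists_nat_large (s : ℂ) (L m : ℕ) : ∃ M : ℕ, m + 1 ≤ M ∧ L + 1 + s.re < M := by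
  obtain ⟨M, hM⟩ := exists_nat_gt (L + 1 + s.re)
  refine ⟨max (m + 1) M, le_max_left _ _, hM.trans_le ?_⟩
  exact_mod_cast le_max_right _ _

/-! ### The heat kernel of the lattice -/

/-- The spectral parameter `4 sin² (π u)`. -/
def spectralParam (u : ℝ) : ℝ := 4 * Real.sin (Real.pi * u) ^ 2

lemma continuous_spectralParam : Continuous spectralParam := by
  unfold spectralParam
  fun_prop

lemma spectralParam_pos {u : ℝ} (h0 : 0 < u) (h1 : u < 1) : 0 < spectralParam u := by
  have := sin_pi_mul_pos h0 h1
  unfold spectralParam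
  positivity

lemma spectralParam_nonneg (u : ℝ) : 0 ≤ spectralParam u := by
  unfold spectralParam
  positivity

lemma spectralParam_le (u : ℝ) : spectralParam u ≤ 4 := by
  unfold spectralParam
  linarith [Real.sin_sq_le_one (Real.pi * u)]

lemma ofReal_spectralParam (u : ℝ) : (spectralParam u : ℂ) =
    2 - Complex.exp (2 * Real.pi * I * u) - Complex.exp (-(2 * Real.pi * I * u)) := by
  have h1 : spectralParam u = 2 - 2 * Real.cos (2 * (Real.pi * u)) := by
    rw [spectralParam, Real.cos_two_mul, Real.cos_sq']
    ring
  rw [h1]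
  push_cast
  rw [Complex.cos, show 2 * (Real.pi * u : ℂ) * I = 2 * Real.pi * I * u by ring,
    show -(2 * (Real.pi * u) : ℂ) * I = -(2 * Real.pi * I * u) by ring]
  ring

lemma integral_exp_two_pi_int (x : ℤ) :
    ∫ u in (0 : ℝ)..1, Complex.exp (2 * Real.pi * I * x * u) = if x = 0 then 1 else 0 := by
  split_ifs with h
  · simp [h]
  · have hc : (2 * Real.pi * I * x : ℂ) ≠ 0 := by
      simp [Real.pi_pos.ne', h]
    rw [integral_exp_mul_complex hc]
    have : Complex.exp (2 * Real.pi * I * x * (1 : ℝ)) = 1 := by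
      rw [Complex.exp_eq_one_iff]
      exact ⟨x, by push_cast; ring⟩
    rw [this]
    simp

/-- Under Fourier series the Laplacian becomes multiplication by `spectralParam`, and the delta
function at `0` becomes the constant `1`. -/
lemma latticeLaplacian_iterate (k : ℕ) (x : ℤ) :
    (latticeLaplacian^[k] (Pi.single 0 1)) x =
      ∫ u in (0 : ℝ)..1, (spectralParam u : ℂ) ^ k * Complex.exp (2 * Real.pi * I * x * u) := by
  induction k generalizing x with
  | zero =>
    simp only [Function.iterate_zero, id_eq, pow_zero, one_mul]
    rw [integral_exp_two_pi_int, Pi.single_apply]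
  | succ k ih =>
    have hc : ∀ y : ℤ, Continuous fun u : ℝ => (spectralParam u : ℂ) ^ k *
        Complex.exp (2 * Real.pi * I * y * u) := fun y => by
      have := continuous_spectralParam
      fun_prop
    rw [Function.iterate_succ_apply', latticeLaplacian, ih, ih, ih,
      ← intervalIntegral.integral_const_mul,
      ← intervalIntegral.integral_sub (((hc _).const_mul 2).intervalIntegrable _ _)
        ((hc _).intervalIntegrable _ _),
      ← intervalIntegral.integral_sub
        ((((hc _).const_mul 2).fun_sub (hc _)).intervalIntegrable _ _) ((hc _).intervalIntegrable _ _)]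
    refine intervalIntegral.integral_congr fun u _ => ?_
    rw [pow_succ, ofReal_spectralParam,
      show (2 * Real.pi * I * ((x + 1 : ℤ) : ℂ) * u : ℂ) =
        2 * Real.pi * I * x * u + 2 * Real.pi * I * u by push_cast; ring,
      show (2 * Real.pi * I * ((x - 1 : ℤ) : ℂ) * u : ℂ) =
        2 * Real.pi * I * x * u + -(2 * Real.pi * I * u) by push_cast; ring,
      Complex.exp_add, Complex.exp_add]
    ring

lemma latticeHeatKernel_eq (t : ℝ) :
    latticeHeatKernel t 0 0 = ∫ u in Set.Ioc (0 : ℝ) 1, Complex.exp (-(spectralParam u * t)) := by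
  set F : ℕ → ℝ → ℂ := fun k u => (-(t : ℂ)) ^ k / (k.factorial : ℂ) * (spectralParam u : ℂ) ^ k
    with hF
  have hc : ∀ k, Continuous (F k) := fun k => by
    have := continuous_spectralParam
    fun_prop
  have hint : ∀ k, Integrable (F k) (volume.restrict (Set.Ioc (0 : ℝ) 1)) := fun k => by
    have := (hc k).intervalIntegrable (μ := volume) 0 1
    rwa [intervalIntegrable_iff_integrableOn_Ioc_of_le zero_le_one] at this
  have hb : ∀ k u, ‖F k u‖ ≤ (|t| * 4) ^ k / k.factorial := fun k u => by
    simp only [hF]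
    rw [norm_mul, norm_div, norm_pow, norm_neg, norm_pow, Complex.norm_real, Complex.norm_real,
      Complex.norm_natCast, Real.norm_eq_abs, Real.norm_of_nonneg (spectralParam_nonneg u),
      div_mul_eq_mul_div, mul_pow]
    have := spectralParam_nonneg u
    gcongr
    exact spectralParam_le u
  have hsum : Summable fun k => ∫ u in Set.Ioc (0 : ℝ) 1, ‖F k u‖ := by
    refine Summable.of_nonneg_of_le (fun k => integral_nonneg fun _ => norm_nonneg _) (fun k => ?_)
      (Real.summable_pow_div_factorial (|t| * 4))
    calc _ ≤ ∫ u in Set.Ioc (0 : ℝ) 1, (|t| * 4) ^ k / k.factorial :=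
          integral_mono (hint k).norm (by simp) fun u => hb k u
      _ = _ := by simp
  have hS := hasSum_integral_of_summable_integral_norm hint hsum
  have hterm : ∀ k, (-(t : ℂ)) ^ k / (k.factorial : ℂ) *
      (latticeLaplacian^[k] (Pi.single 0 1)) 0 = ∫ u in Set.Ioc (0 : ℝ) 1, F k u := fun k => by
    rw [latticeLaplacian_iterate, intervalIntegral.integral_of_le zero_le_one]
    simp only [hF]
    rw [integral_const_mul]
    simp
  rw [latticeHeatKernel]
  simp only [hterm]
  rw [hS.tsum_eq]
  refine setIntegral_congr_fun measurableSet_Ioc fun u _ => ?_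
  have he := NormedSpace.expSeries_div_hasSum_exp (-(spectralParam u * t) : ℂ)
  rw [← Complex.exp_eq_exp_ℂ] at he
  refine ((he.congr_fun fun k => ?_).tsum_eq)
  simp only [hF]
  rw [← mul_neg, mul_pow]
  ring

/-! ### The Mellin transform of the heat kernel -/

/-- Jordan's inequality gives `sin πv ≥ 2v` on `[0, 1/2]`; the other half follows by symmetry. The
majorant is integrable when `σ < 1/2`. -/
lemma spectralParam_rpow_le {σ : ℝ} (hσ : 0 < σ) {u : ℝ} (h0 : 0 < u) (h1 : u < 1) :
    spectralParam u ^ (-σ) ≤ u ^ (-2 * σ) + (1 - u) ^ (-2 * σ) := by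
  have key : ∀ v : ℝ, 0 < v → v ≤ 1 / 2 → spectralParam v ^ (-σ) ≤ v ^ (-2 * σ) := by
    intro v hv hv2
    have hs : 2 * v ≤ Real.sin (Real.pi * v) := by
      have := Real.mul_le_sin (x := Real.pi * v) (by positivity) (by nlinarith [Real.pi_pos])
      calc 2 * v = 2 / Real.pi * (Real.pi * v) := by field_simp
        _ ≤ _ := this
    have h2 : v ^ 2 ≤ spectralParam v := by
      unfold spectralParam
      nlinarith
    calc spectralParam v ^ (-σ) ≤ (v ^ 2) ^ (-σ) :=
          Real.rpow_le_rpow_of_nonpos (by positivity) h2 (by linarith)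
      _ = v ^ (-2 * σ) := by
        rw [← Real.rpow_natCast, ← Real.rpow_mul hv.le]
        push_cast
        ring_nf
  have hn1 : 0 ≤ u ^ (-2 * σ) := Real.rpow_nonneg h0.le _
  have hn2 : 0 ≤ (1 - u) ^ (-2 * σ) := Real.rpow_nonneg (by linarith) _
  rcases le_total u (1 / 2) with h | h
  · linarith [key u h0 h]
  · have h3 := key (1 - u) (by linarith) (by linarith)
    have h4 : spectralParam (1 - u) = spectralParam u := by
      rw [spectralParam, spectralParam, mul_sub, mul_one, Real.sin_pi_sub]
    rw [h4] at h3
    linarith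

lemma integrable_spectralParam_rpow {σ : ℝ} (h0 : 0 < σ) (h1 : σ < 1 / 2) :
    Integrable (fun u => spectralParam u ^ (-σ)) (volume.restrict (Set.Ioo (0 : ℝ) 1)) := by
  have hi : IntervalIntegrable (fun u : ℝ => u ^ (-2 * σ)) volume 0 1 :=
    intervalIntegral.intervalIntegrable_rpow' (by linarith)
  have hi2 : IntervalIntegrable (fun u : ℝ => (1 - u) ^ (-2 * σ)) volume 0 1 := by
    simpa using (hi.comp_sub_left 1).symm
  have hi3 := hi.add hi2
  rw [intervalIntegrable_iff_integrableOn_Ioo_of_le zero_le_one] at hi3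
  refine Integrable.mono' hi3 ?_ ?_
  · exact (continuous_spectralParam.measurable.pow_const _).aestronglyMeasurable
  · refine (ae_restrict_iff' measurableSet_Ioo).2 (Eventually.of_forall fun u hu => ?_)
    rw [Real.norm_of_nonneg (Real.rpow_nonneg (spectralParam_nonneg u) _)]
    exact spectralParam_rpow_le h0 hu.1 hu.2

lemma symbol_eq_spectralParam (s : ℂ) (u : ℝ) : symbol s u = (spectralParam u : ℂ) ^ (-s) := rfl

lemma norm_symbol {s : ℂ} {u : ℝ} (h0 : 0 < u) (h1 : u < 1) :
    ‖symbol s u‖ = spectralParam u ^ (-s.re) := by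
  rw [symbol_eq_spectralParam, Complex.norm_cpow_eq_rpow_re_of_pos (spectralParam_pos h0 h1),
    Complex.neg_re]

lemma measurable_symbol (s : ℂ) : Measurable (symbol s) := by
  have : Measurable fun u => (spectralParam u : ℂ) :=
    Complex.measurable_ofReal.comp continuous_spectralParam.measurable
  exact this.pow_const (-s)

lemma integrable_symbol {s : ℂ} (h0 : 0 < s.re) (h1 : s.re < 1 / 2) :
    Integrable (symbol s) (volume.restrict (Set.Ioo (0 : ℝ) 1)) := by
  refine Integrable.mono' (integrable_spectralParam_rpow h0 h1)
    (measurable_symbol s).aestronglyMeasurable ?_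
  refine (ae_restrict_iff' measurableSet_Ioo).2 (Eventually.of_forall fun u hu => ?_)
  exact (norm_symbol hu.1 hu.2).le

/-- In the strip nothing needs to be subtracted: with `M = 0` the remainder is the symbol itself,
and its expansion can be integrated term by term. -/
lemma integral_symbol {s : ℂ} (h0 : 0 < s.re) (h1 : s.re < 1 / 2) :
    ∫ u in Set.Ioo (0 : ℝ) 1, symbol s u = latticeZeta s := by
  have hi : IntervalIntegrable (symbol s) volume 0 1 := by
    rw [intervalIntegrable_iff_integrableOn_Ioo_of_le zero_le_one]
    exact integrable_symbol h0 h1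
  rw [← integral_Ioc_eq_integral_Ioo, ← intervalIntegral.integral_of_le zero_le_one,
    integral_eq_two_mul_of_symm hi fun x _ => symbol_one_sub s x,
    intervalIntegral.integral_of_le (by norm_num)]
  have h2 := integral_symbolRemainder (M := 0) (s := s) (by simpa using h1)
  have h3 : ∫ x in Set.Ioc (0 : ℝ) (1 / 2), symbolRemainder 0 s x =
      ∫ x in Set.Ioc (0 : ℝ) (1 / 2), symbol s x :=
    setIntegral_congr_fun measurableSet_Ioc fun x hx => by
      simpa using (symbol_eq_sum hx.1 (by linarith [hx.2]) 0 s).symm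
  rw [← h3, ← h2.tsum_eq]
  simp only [add_zero]
  rw [tsum_div_const, latticeZeta]
  ring

/-- The integrand of the double integral that represents the Mellin transform of the heat
kernel. -/
def mellinIntegrand (s : ℂ) (p : ℝ × ℝ) : ℂ :=
  (p.1 : ℂ) ^ (s - 1) * Complex.exp (-(spectralParam p.2 * p.1))

lemma integral_mellinIntegrand {s : ℂ} (hs : 0 < s.re) {u : ℝ} (h0 : 0 < u) (h1 : u < 1) :
    ∫ t in Set.Ioi (0 : ℝ), mellinIntegrand s (t, u) = Complex.Gamma s * symbol s u := by
  have hl := spectralParam_pos h0 h1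
  have := Complex.integral_cpow_mul_exp_neg_mul_Ioi hs hl
  simp only [mellinIntegrand]
  rw [this, symbol_eq_spectralParam, one_div, Complex.inv_cpow _ _ (by
    rw [Complex.arg_ofReal_of_nonneg hl.le]; exact Real.pi_pos.ne), Complex.cpow_neg]
  ring

lemma norm_mellinIntegrand {s : ℂ} {t : ℝ} (ht : 0 < t) (u : ℝ) :
    ‖mellinIntegrand s (t, u)‖ = t ^ (s.re - 1) * Real.exp (-(spectralParam u * t)) := by
  simp only [mellinIntegrand]
  rw [norm_mul, Complex.norm_cpow_eq_rpow_re_of_pos ht, ← Complex.ofReal_mul,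
    ← Complex.ofReal_neg, Complex.norm_exp_ofReal]
  simp

lemma integrable_mellinIntegrand {s : ℂ} (h0 : 0 < s.re) (h1 : s.re < 1 / 2) :
    Integrable (mellinIntegrand s)
      ((volume.restrict (Set.Ioi (0 : ℝ))).prod (volume.restrict (Set.Ioo (0 : ℝ) 1))) := by
  have hm : Measurable (mellinIntegrand s) := by
    have h2 : Measurable fun p : ℝ × ℝ => (p.1 : ℂ) ^ (s - 1) :=
      (Complex.measurable_ofReal.comp measurable_fst).pow_const _
    have h3 : Continuous fun p : ℝ × ℝ => Complex.exp (-(spectralParam p.2 * p.1)) := by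
      have := continuous_spectralParam
      fun_prop
    exact h2.mul h3.measurable
  rw [integrable_prod_iff' hm.aestronglyMeasurable]
  constructor
  · refine (ae_restrict_iff' measurableSet_Ioo).2 (Eventually.of_forall fun u hu => ?_)
    -- A non-integrable function has integral `0` by convention, whereas the integral here is the
    -- nonzero number `Γ(s) symbol s u`.
    by_contra hcon
    have h2 := integral_mellinIntegrand h0 hu.1 hu.2
    rw [integral_undef hcon, symbol_eq_spectralParam] at h2
    have hl : (spectralParam u : ℂ) ≠ 0 := by
      exact_mod_cast (spectralParam_pos hu.1 hu.2).ne'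
    refine mul_ne_zero (Complex.Gamma_ne_zero_of_re_pos h0) ?_ h2.symm
    exact fun h => hl ((Complex.cpow_eq_zero_iff _ _).1 h).1
  · refine ((integrable_spectralParam_rpow h0 h1).const_mul (Real.Gamma s.re)).congr ?_
    refine (ae_restrict_iff' measurableSet_Ioo).2 (Eventually.of_forall fun u hu => ?_)
    have hl := spectralParam_pos hu.1 hu.2
    simp only
    rw [setIntegral_congr_fun measurableSet_Ioi fun t ht =>
      norm_mellinIntegrand (s := s) (Set.mem_Ioi.1 ht) u,
      Real.integral_rpow_mul_exp_neg_mul_Ioi h0 hl, one_div, Real.inv_rpow hl.le,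
      Real.rpow_neg hl.le]
    ring

lemma cpow_smul_latticeHeatKernel (s : ℂ) (t : ℝ) :
    (t : ℂ) ^ (s - 1) • latticeHeatKernel t 0 0 =
      ∫ u in Set.Ioo (0 : ℝ) 1, mellinIntegrand s (t, u) := by
  rw [latticeHeatKernel_eq, smul_eq_mul, integral_Ioc_eq_integral_Ioo, ← integral_const_mul]
  rfl

/-- By Fubini, the Mellin transform of the heat kernel is the integral over `u` of `∫ t^(s-1)
e^(-tλ(u)) dt = Γ(s) λ(u)^(-s)`, with `λ = spectralParam`. -/
lemma isLatticeZeta_latticeZeta : IsLatticeZeta latticeZeta where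
  mellinConvergent s h0 h1 := by
    have := (integrable_mellinIntegrand h0 h1).integral_prod_left
    refine Integrable.congr this (Eventually.of_forall fun t => ?_)
    exact (cpow_smul_latticeHeatKernel s t).symm
  eq_mellin s h0 h1 := by
    have hG := Complex.Gamma_ne_zero_of_re_pos h0
    have h2 : mellin (fun t : ℝ => latticeHeatKernel t 0 0) s =
        Complex.Gamma s * latticeZeta s := by
      rw [mellin]
      simp only [cpow_smul_latticeHeatKernel]
      rw [integral_integral_swap (f := fun t u => mellinIntegrand s (t, u))
        (integrable_mellinIntegrand h0 h1),
        setIntegral_congr_fun measurableSet_Ioo fun u hu =>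
          integral_mellinIntegrand h0 hu.1 hu.2,
        integral_const_mul, integral_symbol h0 h1]
    rw [h2, inv_mul_cancel_left₀ hG]
  differentiableOn := differentiableOn_latticeZeta

end BundleZeta

end

theorem mainTheorem2 :
    (∃ Z : ℂ → ℂ, BundleZeta.IsLatticeZeta Z ∧
      ∀ s : ℂ, (∀ k : ℕ, s ≠ (k : ℂ) + 1 / 2) → ∀ θ : ℝ, 0 < θ → θ < 1 → ∀ m : ℕ,
        (fun n : ℕ => BundleZeta.discreteZeta n s θ -
          ((n : ℂ) * Z s + (n : ℂ) ^ (2 * s) *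
            ∑ k ∈ Finset.range (m + 1),
              BundleZeta.taylorCoeff k s * BundleZeta.circleZeta (s - k) θ / (n : ℂ) ^ (2 * k)))
        =O[atTop] fun n : ℕ => (n : ℂ) ^ (2 * s) / (n : ℂ) ^ (2 + 2 * m)) ∧
    (∀ θ : ℝ, 0 < θ → θ < 1 →
      (∀ (n : ℕ) (s : ℂ), DifferentiableAt ℝ (fun t : ℝ => BundleZeta.discreteZeta n s t) θ) ∧
      (∀ s : ℂ, s ≠ 1 / 2 →
        HasDerivAt (fun t : ℝ => BundleZeta.circleZeta s t) (BundleZeta.circleZetaDeriv s θ) θ) ∧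
      Differentiable ℂ (fun s : ℂ => BundleZeta.circleZetaDeriv s θ) ∧
      ∀ (s : ℂ) (m : ℕ),
        (fun n : ℕ => deriv (fun t : ℝ => BundleZeta.discreteZeta n s t) θ -
          (n : ℂ) ^ (2 * s) *
            ∑ k ∈ Finset.range (m + 1),
              BundleZeta.taylorCoeff k s * BundleZeta.circleZetaDeriv (s - k) θ /
                (n : ℂ) ^ (2 * k))
        =O[atTop] fun n : ℕ => (n : ℂ) ^ (2 * s) / (n : ℂ) ^ (2 + 2 * m)) := by
  refine ⟨⟨BundleZeta.latticeZeta, BundleZeta.isLatticeZeta_latticeZeta,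
    fun s hs θ h0 h1 m => ?_⟩, fun θ h0 h1 => ⟨fun n s => ?_, fun s _ => ?_, ?_, fun s m => ?_⟩⟩
  · simp only [← sub_sub]
    refine BundleZeta.isBigO_of_expansion
      (F := fun n => BundleZeta.discreteZeta n s θ - n * BundleZeta.latticeZeta s) fun L => ?_
    obtain ⟨M, hmM, hM⟩ := BundleZeta.exists_nat_large s L m
    exact ⟨M, hmM, BundleZeta.exists_discreteZeta_expansion hs h0 h1 L M hM⟩
  · exact (BundleZeta.hasDerivAt_discreteZeta h0 h1 n s).differentiableAt
  · exact BundleZeta.hasDerivAt_circleZeta h0 h1 s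
  · exact BundleZeta.differentiable_circleZetaDeriv θ
  · refine BundleZeta.isBigO_of_expansion fun L => ?_
    obtain ⟨M, hmM, hM⟩ := BundleZeta.exists_nat_large s L m
    exact ⟨M, hmM, BundleZeta.exists_deriv_discreteZeta_expansion s h0 h1 L M hM⟩
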